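/- **Setting.** Let $(X,Y)$ be a random pair with values in $\mathbb{R}^d\times\mathbb{R}$ such that $\mathbb{E}\|X\|^2<\infty$, $\mathbb{E}|Y|<\infty$, $\mathbb{E}\|XY\|<\infty$ and $\Sigma:=\mathbb{E}[XX^\top]$ is invertible. Put $\beta:=\Sigma^{-1}\mathbb{E}[XY]$, $b(X):=\mathbb{E}[Y\mid X]-X^\top\beta$ (approximation error) and $\eta(X):=Y-\mathbb{E}[Y\mid X]$ (noise). Let $(X_1,Y_1),\dots,(X_n,Y_n)$ be independent copies of $(X,Y)$; for a quantity depending on $(X,Y)$, $\hat{\mathbb{E}}[\cdot]$ denotes the average of its values at the $n$ observations. Put $\hat\Sigma:=\hat{\mathbb{E}}[XX^\top]$ and, when $\hat\Sigma$ is invertible, $\hat\beta_{\mathrm{ols}}:=\hat\Sigma^{-1}\hat{\mathbb{E}}[XY]$. Here $\|\cdot\|$ is the Euclidean norm of a vector and the spectral norm of a matrix, and $\|x\|_\Sigma:=\sqrt{x^\top\Sigma x}$. **Conditions.** * (N) Subgaussian noise: $\sigma\ge 0$ and, for every $\lambda\in\mathbb{R}$, $\mathbb{E}[\exp(\lambda\eta(X))\mid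 X]\le\exp(\lambda^2\sigma^2/2)$ almost surely. * (A) Bounded approximation error: $B\ge 0$ and $\|\Sigma^{-1/2}Xb(X)\|\le B\sqrt d$ almost surely. * (C1) Subgaussian projections: $\rho_1\ge 1$ and $\mathbb{E}[\exp(\alpha^\top\Sigma^{-1/2}X)]\le\exp(\rho_1\|\alpha\|^2/2)$ for all $\alpha\in\mathbb{R}^d$. * (C2) Bounded statistical leverage: $\rho_2\ge 1$ and $\|\Sigma^{-1/2}X\|/\sqrt d\le\rho_2$ almost surely. For $\delta\in(0,1)$ let $$n_{1,\delta}:=70\rho_1^2\bigl(d\log 41+\log(2/\delta)\bigr),\qquad n_{2,\delta}:=4\rho_2^2\,d\log(d/\delta),$$ $$K_{1,\delta,n}:=\frac{1}{1-\frac{10\rho_1}{9}\Bigl(\sqrt{\frac{32(d\log 41+\log(2/\delta))}{n}}+\frac{2(d\log 41+\log(2/\delta))}{n}\Bigr)},\qquad K_{2,\delta,n}:=\frac{1}{1-\sqrt{\frac{2\rho_2^2d\log(d/\delta)}{n}}}.$$ **Theorem (misspecified model).** Fix $\delta\in(0,1)$ and suppose that (N), (A) and (C1) hold. If $n>n_{1,\delta}$,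 then, with $K:=K_{1,\delta,n}$, we have $K\le 5$, and with probability at least $1-3\delta$ the matrix $\hat\Sigma$ is positive definite and all of the following hold: * (Matrix errors) $\|\Sigma^{1/2}\hat\Sigma^{-1}\Sigma^{1/2}\|\le K$. * (Approximation error contribution) $$\bigl\|\hat{\mathbb{E}}[\hat\Sigma^{-1}Xb(X)]\bigr\|_\Sigma^2\le K^2\left(\frac{4\,\mathbb{E}\bigl[\|\Sigma^{-1/2}Xb(X)\|^2\bigr]\bigl(1+8\log(1/\delta)\bigr)}{n}+\frac{3B^2d\log^2(1/\delta)}{n^2}\right).$$ * (Noise contribution) $$\bigl\|\hat{\mathbb{E}}[\hat\Sigma^{-1}X\eta(X)]\bigr\|_\Sigma^2\le K\cdot\frac{\sigma^2\bigl(d+2\sqrt{d\log(1/\delta)}+2\log(1/\delta)\bigr)}{n}.$$ * (Excess loss) $$\|\hat\beta_{\mathrm{ols}}-\beta\|_\Sigma\le\bigl\|\hat{\mathbb{E}}[\hat\Sigma^{-1}Xb(X)]\bigr\|_\Sigma+\bigl\|\hat{\mathbb{E}}[\hat\Sigma^{-1}X\eta(X)]\bigr\|_\Sigma,$$ $$\|\hat\beta_{\mathrm{ols}}-\beta\|_\Sigma^2\le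 2\bigl\|\hat{\mathbb{E}}[\hat\Sigma^{-1}Xb(X)]\bigr\|_\Sigma^2+2\bigl\|\hat{\mathbb{E}}[\hat\Sigma^{-1}X\eta(X)]\bigr\|_\Sigma^2.$$ If instead (N), (A) and (C2) hold and $n>n_{2,\delta}$, then the same conclusions hold with $K:=K_{2,\delta,n}$. -/

import Mathlib

open MeasureTheory ProbabilityTheory
open scoped MatrixOrder

namespace RandomDesign

noncomputable section

/-- The spectral norm of a matrix: the operator norm for the Euclidean norm. -/
def specNorm {d : ℕ} (M : Matrix (Fin d) (Fin d) ℝ) : ℝ :=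
  ‖Matrix.toEuclideanCLM (n := Fin d) (𝕜 := ℝ) M‖

/-- The norm `‖x‖_M = √(xᵀ M x)` of a positive semidefinite matrix `M`. -/
def matNorm {d : ℕ} (M : Matrix (Fin d) (Fin d) ℝ) (x : EuclideanSpace ℝ (Fin d)) : ℝ :=
  √(inner ℝ x (Matrix.toEuclideanLin M x))

/-- `M ^ (1/2)`, the positive semidefinite square root of a positive semidefinite matrix. -/
def halfPow {d : ℕ} (M : Matrix (Fin d) (Fin d) ℝ) : Matrix (Fin d) (Fin d) ℝ :=
  CFC.sqrt M

/-- `M ^ (-1/2)`. -/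
def negHalfPow {d : ℕ} (M : Matrix (Fin d) (Fin d) ℝ) : Matrix (Fin d) (Fin d) ℝ :=
  (halfPow M)⁻¹

section Population

variable {Ω : Type*} [MeasurableSpace Ω] {d : ℕ}

/-- `Σ = E[X Xᵀ]`. -/
def secondMoment (μ : Measure Ω) (X : Ω → EuclideanSpace ℝ (Fin d)) :
    Matrix (Fin d) (Fin d) ℝ :=
  Matrix.of fun i j => ∫ ω, X ω i * X ω j ∂μ

/-- `β = Σ⁻¹ E[X Y]`. -/
def popCoef (μ : Measure Ω) (X : Ω → EuclideanSpace ℝ (Fin d)) (Y : Ω → ℝ) :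
    EuclideanSpace ℝ (Fin d) :=
  Matrix.toEuclideanLin (secondMoment μ X)⁻¹ (∫ ω, Y ω • X ω ∂μ)

/-- The regression function `x ↦ E[Y | X = x]`, the mean of the regular conditional distribution
of `Y` given `X = x`. -/
def regression (μ : Measure Ω) [IsFiniteMeasure μ] (X : Ω → EuclideanSpace ℝ (Fin d))
    (Y : Ω → ℝ) (x : EuclideanSpace ℝ (Fin d)) : ℝ :=
  ∫ y, y ∂(condDistrib Y X μ x)

theorem regression_comp_ae_eq_condExp (μ : Measure Ω) [IsFiniteMeasure μ]
    {X : Ω → EuclideanSpace ℝ (Fin d)} {Y : Ω → ℝ} (hX : Measurable X) (hY : Integrable Y μ) :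
    (fun ω => regression μ X Y (X ω)) =ᵐ[μ] μ[Y | MeasurableSpace.comap X inferInstance] :=
  (condExp_ae_eq_integral_condDistrib' hX hY).symm

/-- The approximation error `b(x) = E[Y | X = x] - xᵀ β`. -/
def approxErr (μ : Measure Ω) [IsFiniteMeasure μ] (X : Ω → EuclideanSpace ℝ (Fin d))
    (Y : Ω → ℝ) (x : EuclideanSpace ℝ (Fin d)) : ℝ :=
  regression μ X Y x - inner ℝ x (popCoef μ X Y)

/-- The response noise `y - E[Y | X = x]` of an observation `(x, y)`. -/
def noise (μ : Measure Ω) [IsFiniteMeasure μ] (X : Ω → EuclideanSpace ℝ (Fin d))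
    (Y : Ω → ℝ) (x : EuclideanSpace ℝ (Fin d)) (y : ℝ) : ℝ :=
  y - regression μ X Y x

/-- The whitened vector `Σ^(-1/2) X b(X)` at a covariate `x`. -/
def whitenedApprox (μ : Measure Ω) [IsFiniteMeasure μ] (X : Ω → EuclideanSpace ℝ (Fin d))
    (Y : Ω → ℝ) (x : EuclideanSpace ℝ (Fin d)) : EuclideanSpace ℝ (Fin d) :=
  Matrix.toEuclideanLin (negHalfPow (secondMoment μ X)) (approxErr μ X Y x • x)

/-- Subgaussian noise. The integrability clause only says that the conditional expectation of the
positive variable is finite, so that Mathlib's conditional expectation is the true one. -/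
def SubgaussianNoise (μ : Measure Ω) [IsFiniteMeasure μ] (X : Ω → EuclideanSpace ℝ (Fin d))
    (Y : Ω → ℝ) (σ : ℝ) : Prop :=
  0 ≤ σ ∧ ∀ l : ℝ,
    Integrable (fun ω => Real.exp (l * noise μ X Y (X ω) (Y ω))) μ ∧
    ∀ᵐ ω ∂μ,
      (μ[fun ω' => Real.exp (l * noise μ X Y (X ω') (Y ω')) |
          MeasurableSpace.comap X inferInstance]) ω
        ≤ Real.exp (l ^ 2 * σ ^ 2 / 2)

/-- Bounded approximation error: `‖Σ^(-1/2) X b(X)‖ ≤ B √d` almost surely. -/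
def BoundedApprox (μ : Measure Ω) [IsFiniteMeasure μ] (X : Ω → EuclideanSpace ℝ (Fin d))
    (Y : Ω → ℝ) (B : ℝ) : Prop :=
  0 ≤ B ∧ ∀ᵐ ω ∂μ, ‖whitenedApprox μ X Y (X ω)‖ ≤ B * √d

/-- Subgaussian projections of the whitened covariates. -/
def SubgaussianProjections (μ : Measure Ω) (X : Ω → EuclideanSpace ℝ (Fin d)) (ρ : ℝ) : Prop :=
  1 ≤ ρ ∧ ∀ α : EuclideanSpace ℝ (Fin d),
    Integrable (fun ω => Real.exp
      (inner ℝ α (Matrix.toEuclideanLin (negHalfPow (secondMoment μ X)) (X ω)))) μ ∧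
    ∫ ω, Real.exp (inner ℝ α (Matrix.toEuclideanLin (negHalfPow (secondMoment μ X)) (X ω))) ∂μ
      ≤ Real.exp (ρ * ‖α‖ ^ 2 / 2)

/-- Bounded statistical leverage. -/
def BoundedLeverage (μ : Measure Ω) (X : Ω → EuclideanSpace ℝ (Fin d)) (ρ : ℝ) : Prop :=
  1 ≤ ρ ∧ ∀ᵐ ω ∂μ,
    ‖Matrix.toEuclideanLin (negHalfPow (secondMoment μ X)) (X ω)‖ / √d ≤ ρ

end Population

section Sample

variable {n d : ℕ}

/-- The empirical mean `Ê[v] = (1/n) ∑ v_k`. -/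
def empMean (v : Fin n → EuclideanSpace ℝ (Fin d)) : EuclideanSpace ℝ (Fin d) :=
  (n : ℝ)⁻¹ • ∑ k, v k

/-- The empirical second moment matrix `Σ̂ = (1/n) ∑ x_k x_kᵀ`. -/
def empSecondMoment (x : Fin n → EuclideanSpace ℝ (Fin d)) : Matrix (Fin d) (Fin d) ℝ :=
  Matrix.of fun i j => (∑ k, x k i * x k j) / (n : ℝ)

/-- The ordinary least squares estimator `Σ̂⁻¹ Ê[X Y]`. -/
def ols (x : Fin n → EuclideanSpace ℝ (Fin d)) (y : Fin n → ℝ) : EuclideanSpace ℝ (Fin d) :=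
  Matrix.toEuclideanLin (empSecondMoment x)⁻¹ (empMean fun k => y k • x k)

/-- `Ê[Σ̂⁻¹ X u]` for scalars `u_1, …, u_n` attached to the observations. -/
def empContribution (x : Fin n → EuclideanSpace ℝ (Fin d)) (u : Fin n → ℝ) :
    EuclideanSpace ℝ (Fin d) :=
  empMean fun k => Matrix.toEuclideanLin (empSecondMoment x)⁻¹ (u k • x k)

end Sample

/-- The sample size threshold under subgaussian projections. -/
def n₁ (ρ : ℝ) (d : ℕ) (δ : ℝ) : ℝ :=
  70 * ρ ^ 2 * (d * Real.log 41 + Real.log (2 / δ))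

/-- The sample size threshold under bounded statistical leverage. -/
def n₂ (ρ : ℝ) (d : ℕ) (δ : ℝ) : ℝ :=
  4 * ρ ^ 2 * d * Real.log (d / δ)

def K₁ (ρ : ℝ) (d : ℕ) (δ : ℝ) (n : ℕ) : ℝ :=
  1 / (1 - 10 * ρ / 9 *
    (√(32 * (d * Real.log 41 + Real.log (2 / δ)) / n)
      + 2 * (d * Real.log 41 + Real.log (2 / δ)) / n))

def K₂ (ρ : ℝ) (d : ℕ) (δ : ℝ) (n : ℕ) : ℝ :=
  1 / (1 - √(2 * ρ ^ 2 * d * Real.log (d / δ) / n))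

/-- The bounds for one realization `(x_1, y_1), …, (x_n, y_n)` of the sample, with factor `K`:
`Σ̂` is positive definite, the matrix error, the approximation error contribution, the noise
contribution, and the two forms of the excess loss bound. -/
def SampleBounds {Ω : Type*} [MeasurableSpace Ω] {n d : ℕ} (μ : Measure Ω) [IsFiniteMeasure μ]
    (X : Ω → EuclideanSpace ℝ (Fin d)) (Y : Ω → ℝ) (σ B δ K : ℝ)
    (x : Fin n → EuclideanSpace ℝ (Fin d)) (y : Fin n → ℝ) : Prop :=
  let S := secondMoment μ X
  let approx := matNorm S (empContribution x fun k => approxErr μ X Y (x k))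
  let noiseC := matNorm S (empContribution x fun k => noise μ X Y (x k) (y k))
  let excess := matNorm S (ols x y - popCoef μ X Y)
  (empSecondMoment x).PosDef ∧
  specNorm (halfPow S * (empSecondMoment x)⁻¹ * halfPow S) ≤ K ∧
  approx ^ 2 ≤ K ^ 2 *
    (4 * (∫ ω, ‖whitenedApprox μ X Y (X ω)‖ ^ 2 ∂μ) * (1 + 8 * Real.log (1 / δ)) / n
      + 3 * B ^ 2 * d * Real.log (1 / δ) ^ 2 / (n : ℝ) ^ 2) ∧
  noiseC ^ 2 ≤ K *
    (σ ^ 2 * (d + 2 * √(d * Real.log (1 / δ)) + 2 * Real.log (1 / δ)) / n) ∧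
  excess ≤ approx + noiseC ∧
  excess ^ 2 ≤ 2 * approx ^ 2 + 2 * noiseC ^ 2

end

end RandomDesign

open RandomDesign

/-!
Everything about one sample reduces to a single inequality: once the quadratic form of the whitened
empirical second moment is at least `K⁻¹ ‖u‖²`, linear algebra bounds the matrix error by `K`, the
approximation contribution by `K` times the norm of the mean of the whitened vectors `b(x) x`, and
the squared noise contribution by `K` times `⟪m, Σ̂⁻¹ m⟫`, where `m` is the mean of the vectors
`η x`. Three events, each failing with probability at most `δ`, remain.

* Noise. Conditionally on the covariates, `Σ̂ ^ (-1/2) ∑ η x` is a subgaussian vector; integrating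
  its moment generating function against a Gaussian vector bounds the exponential moments of its
  squared norm.
* Approximation error. The vectors `b(x) x` are centred because `β` solves the normal equations, and
  the potential `cosh (λ ‖∑ f‖)` grows by a bounded factor in the mean with each bounded centred
  summand, which gives a Bernstein inequality without dimension factor.
* Lower bound. Under subgaussian projections, the squares `⟪u, w⟫²` have subgamma tails for each
  fixed `u`, and a net of the sphere makes this uniform in `u`. Under bounded leverage, the trace
  of the exponential of `-θ ∑ w wᵀ` is the potential, and the rank-one Golden–Thompson inequality
  controls its growth.
-/

namespace RandomDesign

/-! ### Integration over finite products -/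

section Pi

variable {α : Type*} [MeasurableSpace α]

theorem lintegral_pi_prod {ι : Type*} [Fintype ι] (ν : ι → Measure α)
    [∀ i, IsProbabilityMeasure (ν i)] {f : ι → α → ENNReal} (hf : ∀ i, Measurable (f i)) :
    ∫⁻ z, ∏ i, f i (z i) ∂Measure.pi ν = ∏ i, ∫⁻ a, f i a ∂ν i := by
  rw [lintegral_prod_eq_prod_lintegral_of_indepFun _ _
    (iIndepFun_pi (X := f) fun i => (hf i).aemeasurable) (fun i => by fun_prop)]
  exact Finset.prod_congr rfl fun i _ => (measurePreserving_eval ν i).lintegral_comp (hf i)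

theorem ofReal_exp_sum {ι : Type*} (s : Finset ι) (f : ι → ℝ) :
    ENNReal.ofReal (Real.exp (∑ i ∈ s, f i)) = ∏ i ∈ s, ENNReal.ofReal (Real.exp (f i)) := by
  rw [Real.exp_sum, ENNReal.ofReal_prod_of_nonneg fun _ _ => (Real.exp_pos _).le]

theorem lintegral_pi_exp_sum {ι : Type*} [Fintype ι] (ν : ι → Measure α)
    [∀ i, IsProbabilityMeasure (ν i)] {f : ι → α → ℝ} (hf : ∀ i, Measurable (f i)) :
    ∫⁻ z, ENNReal.ofReal (Real.exp (∑ i, f i (z i))) ∂Measure.pi ν =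
      ∏ i, ∫⁻ a, ENNReal.ofReal (Real.exp (f i a)) ∂ν i := by
  simp only [ofReal_exp_sum]
  exact lintegral_pi_prod ν (f := fun i a => ENNReal.ofReal (Real.exp (f i a)))
    fun i => by fun_prop

variable (ν : Measure α) [IsProbabilityMeasure ν]

theorem lintegral_pi_succ {n : ℕ} {F : (Fin (n + 1) → α) → ENNReal} (hF : Measurable F) :
    ∫⁻ z, F z ∂Measure.pi (fun _ => ν) =
      ∫⁻ a, ∫⁻ z, F (Fin.cons a z) ∂Measure.pi (fun _ : Fin n => ν) ∂ν := by
  have h := (measurePreserving_piFinSuccAbove (fun _ : Fin (n + 1) => ν) 0).symm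
  rw [← h.lintegral_comp hF, lintegral_prod]
  · simp [MeasurableEquiv.piFinSuccAbove, Fin.insertNthEquiv]
  · exact (hF.comp (MeasurableEquiv.measurable _)).aemeasurable

theorem lintegral_potential_sum_le {V : Type*} [AddCommMonoid V] [MeasurableSpace V]
    [MeasurableAdd₂ V] {p : V → Prop} {Φ : ℕ → V → ENNReal} (hΦ : ∀ k, Measurable (Φ k)) {f : α → V}
    (hf : Measurable f) (hp : ∀ s a, p s → p (s + f a))
    (h : ∀ k s, p s → ∫⁻ a, Φ k (s + f a) ∂ν ≤ Φ (k + 1) s) (n : ℕ) {s : V} (hs : p s) :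
    ∫⁻ z, Φ 0 (s + ∑ k : Fin n, f (z k)) ∂Measure.pi (fun _ => ν) ≤ Φ n s := by
  induction n generalizing s with
  | zero => simp
  | succ n ih =>
    rw [lintegral_pi_succ ν (by fun_prop)]
    refine (lintegral_mono fun a => ?_).trans (h n s hs)
    simpa [Fin.sum_univ_succ, add_assoc] using ih (hp s a hs)

end Pi

section PiKernel

variable {ι 𝓧 𝓨 : Type*} [Fintype ι] [MeasurableSpace 𝓧] [MeasurableSpace 𝓨]

/-- The product of the measures `κ (x i)` over the coordinates `i`, as a kernel in `x`: the law of
independent responses to the covariates `x`. -/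
noncomputable def piKernel (ι : Type*) [Fintype ι] (κ : Kernel 𝓧 𝓨) [IsMarkovKernel κ] :
    Kernel (ι → 𝓧) (ι → 𝓨) where
  toFun x := Measure.pi fun i => κ (x i)
  measurable' := by
    refine .measure_of_isPiSystem_of_isProbabilityMeasure generateFrom_pi.symm isPiSystem_pi ?_
    rintro _ ⟨t, ht, rfl⟩
    simp only [Measure.pi_pi]
    exact Finset.measurable_prod _ fun i _ =>
      (κ.measurable_coe (ht i trivial)).comp (measurable_pi_apply i)

theorem piKernel_apply (κ : Kernel 𝓧 𝓨) [IsMarkovKernel κ] (x : ι → 𝓧) :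
    piKernel ι κ x = Measure.pi fun i => κ (x i) := rfl

instance (κ : Kernel 𝓧 𝓨) [IsMarkovKernel κ] : IsMarkovKernel (piKernel ι κ) :=
  ⟨fun x => by rw [piKernel_apply]; infer_instance⟩

theorem pi_compProd (ρ : Measure 𝓧) [IsProbabilityMeasure ρ] (κ : Kernel 𝓧 𝓨)
    [IsMarkovKernel κ] :
    Measure.pi (fun _ : ι => ρ ⊗ₘ κ) =
      ((Measure.pi fun _ : ι => ρ) ⊗ₘ piKernel ι κ).map
        (MeasurableEquiv.arrowProdEquivProdArrow 𝓧 𝓨 ι).symm := by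
  refine Measure.pi_eq fun s hs => ?_
  have hpre : MeasurableSet ((MeasurableEquiv.arrowProdEquivProdArrow 𝓧 𝓨 ι).symm ⁻¹'
      Set.univ.pi s) := (MeasurableEquiv.measurable _) (.univ_pi hs)
  rw [Measure.map_apply (MeasurableEquiv.measurable _) (.univ_pi hs), Measure.compProd_apply hpre]
  have hslice (x : ι → 𝓧) : Prod.mk x ⁻¹' ((MeasurableEquiv.arrowProdEquivProdArrow 𝓧 𝓨 ι).symm ⁻¹'
      Set.univ.pi s) = Set.univ.pi fun i => Prod.mk (x i) ⁻¹' s i := by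
    ext y
    simp [MeasurableEquiv.arrowProdEquivProdArrow, Equiv.arrowProdEquivProdArrow]
  simp only [hslice, piKernel_apply, Measure.pi_pi]
  rw [lintegral_pi_prod _ fun i => Kernel.measurable_kernel_prodMk_left (hs i)]
  exact Finset.prod_congr rfl fun i _ => (Measure.compProd_apply (hs i)).symm

end PiKernel

/-! ### Chernoff bounds -/

theorem measure_lt_le_of_lintegral_exp_le {α : Type*} [MeasurableSpace α] {ν : Measure α}
    {W : α → ℝ} (hW : Measurable W) {s a b : ℝ} (hs : 0 ≤ s)
    (h : ∫⁻ z, ENNReal.ofReal (Real.exp (s * W z)) ∂ν ≤ ENNReal.ofReal (Real.exp b)) :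
    ν {z | a < W z} ≤ ENNReal.ofReal (Real.exp (b - s * a)) := by
  have hsub : {z | a < W z} ⊆ {z | ENNReal.ofReal (Real.exp (s * a)) ≤
      ENNReal.ofReal (Real.exp (s * W z))} := fun z hz =>
    ENNReal.ofReal_le_ofReal (Real.exp_le_exp.2 (mul_le_mul_of_nonneg_left (le_of_lt hz) hs))
  have hpos : ENNReal.ofReal (Real.exp (s * a)) ≠ 0 := by simp [Real.exp_pos]
  rw [Real.exp_sub, ENNReal.ofReal_div_of_pos (Real.exp_pos _)]
  refine (measure_mono hsub).trans ((meas_ge_le_lintegral_div (by fun_prop) hpos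
    ENNReal.ofReal_ne_top).trans ?_)
  gcongr

theorem measure_lt_le_of_subgamma {α : Type*} [MeasurableSpace α] {ν : Measure α}
    {W : α → ℝ} (hW : Measurable W) {D t : ℝ} (hD : 0 < D) (ht : 0 ≤ t)
    (h : ∀ s, 0 ≤ s → s < 1 / 2 → ∫⁻ z, ENNReal.ofReal (Real.exp (s * W z)) ∂ν
      ≤ ENNReal.ofReal (Real.exp (D * s ^ 2 / (1 - 2 * s)))) :
    ν {z | 2 * √(D * t) + 2 * t < W z} ≤ ENNReal.ofReal (Real.exp (-t)) := by
  have ha : 0 < √D := Real.sqrt_pos.2 hD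
  have hu : 0 ≤ √t := Real.sqrt_nonneg t
  have hDa : √D ^ 2 = D := Real.sq_sqrt hD.le
  have htu : √t ^ 2 = t := Real.sq_sqrt ht
  have hpos : 0 < √D + 2 * √t := by positivity
  have hs : √t / (√D + 2 * √t) < 1 / 2 := by
    rw [div_lt_div_iff₀ hpos two_pos]; linarith
  have hmarkov := measure_lt_le_of_lintegral_exp_le hW (a := 2 * √(D * t) + 2 * t)
    (by positivity) (h (√t / (√D + 2 * √t)) (by positivity) hs)
  convert hmarkov using 3
  rw [Real.sqrt_mul hD.le]
  have hquot : 1 - 2 * (√t / (√D + 2 * √t)) = √D / (√D + 2 * √t) := by field_simp; ring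
  rw [hquot]
  generalize √D = a at *
  generalize √t = u at *
  subst hDa htu
  field_simp
  ring

/-! ### Gaussian integrals -/

theorem lintegral_exp_mul_gaussian (a : ℝ) :
    ∫⁻ g, ENNReal.ofReal (Real.exp (a * g)) ∂gaussianReal 0 1 =
      ENNReal.ofReal (Real.exp (a ^ 2 / 2)) := by
  rw [← ofReal_integral_eq_lintegral_ofReal (integrable_exp_mul_gaussianReal a)
    (.of_forall fun _ => (Real.exp_pos _).le)]
  have hmgf := mgf_gaussianReal (p := gaussianReal 0 1) (X := id) (μ := 0) (v := 1) (by simp) a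
  simp only [mgf, id] at hmgf
  rw [hmgf]
  simp

theorem gaussianPDFReal_mul_exp_mul_sq (s g : ℝ) :
    gaussianPDFReal 0 1 g * Real.exp (s * g ^ 2) =
      (√(2 * Real.pi))⁻¹ * Real.exp (-(1 / 2 - s) * g ^ 2) := by
  rw [gaussianPDFReal, mul_assoc, ← Real.exp_add]
  simp only [NNReal.coe_one, mul_one, sub_zero]
  ring_nf

theorem lintegral_exp_mul_sq_gaussian {s : ℝ} (hs : s < 1 / 2) :
    ∫⁻ g, ENNReal.ofReal (Real.exp (s * g ^ 2)) ∂gaussianReal 0 1 =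
      ENNReal.ofReal (√(1 - 2 * s)⁻¹) := by
  rw [gaussianReal_of_var_ne_zero _ one_ne_zero,
    lintegral_withDensity_eq_lintegral_mul _ (measurable_gaussianPDF 0 1) (by fun_prop)]
  simp only [Pi.mul_apply, gaussianPDF, ← ENNReal.ofReal_mul (gaussianPDFReal_nonneg 0 1 _),
    gaussianPDFReal_mul_exp_mul_sq]
  rw [← ofReal_integral_eq_lintegral_ofReal
    ((integrable_exp_neg_mul_sq (by linarith)).const_mul _) (.of_forall fun _ => by positivity),
    integral_const_mul, integral_gaussian, ← Real.sqrt_inv, ← Real.sqrt_mul (by positivity)]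
  have hhalf : 1 / 2 - s = (1 - 2 * s) / 2 := by ring
  congr 2
  rw [hhalf]
  field_simp

theorem sqrt_inv_one_sub_le_exp {s : ℝ} (h0 : 0 ≤ s) (hs : s < 1 / 2) :
    √(1 - 2 * s)⁻¹ ≤ Real.exp (s + s ^ 2 / (1 - 2 * s)) := by
  have hx : 0 < 1 - 2 * s := by linarith
  obtain ⟨y, hy⟩ : ∃ y, y = (1 - 2 * s)⁻¹ := ⟨_, rfl⟩
  have hy1 : 1 ≤ y := hy ▸ (one_le_inv₀ hx).2 (by linarith)
  have hy0 : 0 < y := by linarith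
  have hlog : Real.log y ≤ (y - y⁻¹) / 2 :=
    (Real.self_le_sinh_iff.2 (Real.log_nonneg hy1)).trans_eq (Real.sinh_log hy0)
  have hsy : s + s ^ 2 / (1 - 2 * s) = (y - y⁻¹) / 2 / 2 := by
    have hyinv : 1 - 2 * s = y⁻¹ := by rw [hy, inv_inv]
    have hs' : s = (1 - y⁻¹) / 2 := by linarith
    rw [hyinv, hs']
    field_simp
    ring
  rw [← hy, hsy, Real.sqrt_eq_rpow, Real.rpow_def_of_pos hy0]
  exact Real.exp_le_exp.2 (by linarith)

section StdGaussian

variable (E : Type*) [NormedAddCommGroup E] [InnerProductSpace ℝ E] [FiniteDimensional ℝ E]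
  [MeasurableSpace E] [BorelSpace E]

variable {E} in
theorem lintegral_exp_inner_stdGaussian (a : E) :
    ∫⁻ g, ENNReal.ofReal (Real.exp (inner ℝ a g)) ∂stdGaussian E =
      ENNReal.ofReal (Real.exp (‖a‖ ^ 2 / 2)) := by
  rw [stdGaussian, lintegral_map (by fun_prop) (by fun_prop)]
  simp only [inner_sum, real_inner_smul_right, mul_comm _ (inner ℝ a _)]
  rw [lintegral_pi_exp_sum _ (f := fun i x => inner ℝ a (stdOrthonormalBasis ℝ E i) * x)
    fun _ => by fun_prop]
  simp only [lintegral_exp_mul_gaussian]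
  rw [← ofReal_exp_sum, ← Finset.sum_div, (stdOrthonormalBasis ℝ E).sum_sq_inner_left]

theorem lintegral_exp_mul_norm_sq_stdGaussian {s : ℝ} (hs : s < 1 / 2) :
    ∫⁻ g, ENNReal.ofReal (Real.exp (s * ‖g‖ ^ 2)) ∂stdGaussian E =
      ENNReal.ofReal (√(1 - 2 * s)⁻¹) ^ Module.finrank ℝ E := by
  have hnorm (x : Fin (Module.finrank ℝ E) → ℝ) :
      s * ‖∑ i, x i • stdOrthonormalBasis ℝ E i‖ ^ 2 = ∑ i, s * x i ^ 2 := by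
    rw [← real_inner_self_eq_norm_sq, (stdOrthonormalBasis ℝ E).orthonormal.inner_sum,
      Finset.mul_sum]
    simp [sq]
  rw [stdGaussian, lintegral_map (by fun_prop) (by fun_prop)]
  simp only [hnorm]
  rw [lintegral_pi_exp_sum _ (f := fun _ x => s * x ^ 2) fun _ => by fun_prop]
  simp [lintegral_exp_mul_sq_gaussian hs]

end StdGaussian

/-! ### Subgaussian vectors -/

/-- The random vector `w` is subgaussian with variance proxy `v`. The moment generating function is
a Lebesgue integral, so that its finiteness is part of the bound. -/
def IsSubgaussian {α E : Type*} [MeasurableSpace α] [NormedAddCommGroup E] [InnerProductSpace ℝ E]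
    (ν : Measure α) (w : α → E) (v : ℝ) : Prop :=
  ∀ u : E, ∫⁻ a, ENNReal.ofReal (Real.exp (inner ℝ u (w a))) ∂ν ≤
    ENNReal.ofReal (Real.exp (v * ‖u‖ ^ 2 / 2))

namespace IsSubgaussian

variable {α E : Type*} [MeasurableSpace α] [NormedAddCommGroup E] [InnerProductSpace ℝ E]
  {ν : Measure α} {w : α → E} {v : ℝ}

theorem mono (h : IsSubgaussian ν w v) {v' : ℝ} (hv : v ≤ v') : IsSubgaussian ν w v' := fun u =>
  (h u).trans (by gcongr)

theorem inner_left (h : IsSubgaussian ν w v) (u : E) :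
    IsSubgaussian ν (fun a => inner ℝ u (w a)) (v * ‖u‖ ^ 2) := fun l => by
  simpa [real_inner_smul_left, norm_smul, mul_pow, mul_comm, mul_left_comm] using h (l • u)

theorem sum_smul {ι : Type*} [Fintype ι] {κ : ι → Measure α} [∀ i, IsProbabilityMeasure (κ i)]
    {η : ι → α → ℝ} (hη : ∀ i, Measurable (η i)) (h : ∀ i, IsSubgaussian (κ i) (η i) v)
    (hv : 0 ≤ v) (a : ι → E) {c : ℝ} (ha : ∀ u, ∑ i, inner ℝ u (a i) ^ 2 ≤ c * ‖u‖ ^ 2) :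
    IsSubgaussian (Measure.pi κ) (fun y => ∑ i, η i (y i) • a i) (v * c) := fun u => by
  simp only [inner_sum, real_inner_smul_right]
  rw [lintegral_pi_exp_sum κ (f := fun i y => η i y * inner ℝ u (a i)) fun i => by fun_prop]
  calc ∏ i, ∫⁻ y, ENNReal.ofReal (Real.exp (η i y * inner ℝ u (a i))) ∂κ i
      ≤ ∏ i, ENNReal.ofReal (Real.exp (v * inner ℝ u (a i) ^ 2 / 2)) := by
        gcongr with i
        simpa using h i (inner ℝ u (a i))
    _ = ENNReal.ofReal (Real.exp (v * (∑ i, inner ℝ u (a i) ^ 2) / 2)) := by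
        rw [← ofReal_exp_sum, ← Finset.sum_div, ← Finset.mul_sum]
    _ ≤ ENNReal.ofReal (Real.exp (v * c * ‖u‖ ^ 2 / 2)) := by
        rw [mul_assoc v c]
        gcongr
        exact ha u

variable [FiniteDimensional ℝ E] [MeasurableSpace E] [BorelSpace E]

/-- Since `exp (l ‖w‖ ^ 2)` is the mean of `exp ⟪√(2 l) g, w⟫` over a standard Gaussian vector `g`,
the integral over `w` can be taken first. -/
theorem lintegral_exp_mul_norm_sq_le [SFinite ν] (h : IsSubgaussian ν w v) (hw : Measurable w)
    {l : ℝ} (hl : 0 ≤ l) (hlv : l * v < 1 / 2) :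
    ∫⁻ a, ENNReal.ofReal (Real.exp (l * ‖w a‖ ^ 2)) ∂ν ≤
      ENNReal.ofReal (√(1 - 2 * (l * v))⁻¹) ^ Module.finrank ℝ E := by
  have hsq : √(2 * l) ^ 2 = 2 * l := Real.sq_sqrt (by positivity)
  calc ∫⁻ a, ENNReal.ofReal (Real.exp (l * ‖w a‖ ^ 2)) ∂ν
      = ∫⁻ a, ∫⁻ g, ENNReal.ofReal (Real.exp (inner ℝ (√(2 * l) • w a) g)) ∂stdGaussian E ∂ν := by
        refine lintegral_congr fun a => ?_
        rw [lintegral_exp_inner_stdGaussian, norm_smul, mul_pow, Real.norm_eq_abs, sq_abs, hsq]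
        congr 2
        ring
    _ = ∫⁻ g, ∫⁻ a, ENNReal.ofReal (Real.exp (inner ℝ (√(2 * l) • g) (w a))) ∂ν ∂stdGaussian E := by
        rw [lintegral_lintegral_swap (Measurable.aemeasurable (by fun_prop))]
        simp only [real_inner_smul_left, real_inner_comm _ (w _)]
    _ ≤ ∫⁻ g, ENNReal.ofReal (Real.exp (l * v * ‖g‖ ^ 2)) ∂stdGaussian E := by
        refine lintegral_mono fun g => (h (√(2 * l) • g)).trans_eq ?_
        rw [norm_smul, mul_pow, Real.norm_eq_abs, sq_abs, hsq]
        congr 2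
        ring
    _ = _ := lintegral_exp_mul_norm_sq_stdGaussian E hlv

theorem measure_lt_norm_sq_le_of_pos [SFinite ν] (h : IsSubgaussian ν w v) (hw : Measurable w)
    (hv : 0 < v) {t : ℝ} (ht : 0 ≤ t) :
    ν {a | v * (Module.finrank ℝ E + 2 * √(Module.finrank ℝ E * t) + 2 * t) < ‖w a‖ ^ 2} ≤
      ENNReal.ofReal (Real.exp (-t)) := by
  rcases (Module.finrank ℝ E).eq_zero_or_pos with hd | hd
  · have hw0 (a : α) : w a = 0 := finrank_zero_iff_forall_zero.1 hd _
    have hpos : ¬ v * (2 * t) < 0 := by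
      rw [not_lt]; positivity
    simp [hd, hw0, hpos]
  have hmgf (s : ℝ) (hs0 : 0 ≤ s) (hs : s < 1 / 2) :
      ∫⁻ a, ENNReal.ofReal (Real.exp (s * (‖w a‖ ^ 2 / v - Module.finrank ℝ E))) ∂ν ≤
        ENNReal.ofReal (Real.exp (Module.finrank ℝ E * s ^ 2 / (1 - 2 * s))) := by
    have hmul (a : α) : ENNReal.ofReal (Real.exp (s * (‖w a‖ ^ 2 / v - Module.finrank ℝ E))) =
        ENNReal.ofReal (Real.exp (-(Module.finrank ℝ E * s))) *
          ENNReal.ofReal (Real.exp (s / v * ‖w a‖ ^ 2)) := by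
      rw [← ENNReal.ofReal_mul (Real.exp_pos _).le, ← Real.exp_add]
      ring_nf
    have hsv : s / v * v = s := div_mul_cancel₀ s hv.ne'
    have hexp := h.lintegral_exp_mul_norm_sq_le hw (l := s / v) (by positivity) (by rwa [hsv])
    rw [hsv] at hexp
    simp only [hmul]
    rw [lintegral_const_mul _ (by fun_prop)]
    calc _ ≤ ENNReal.ofReal (Real.exp (-(Module.finrank ℝ E * s))) *
          ENNReal.ofReal (Real.exp (s + s ^ 2 / (1 - 2 * s))) ^ Module.finrank ℝ E := by
          grw [hexp, sqrt_inv_one_sub_le_exp hs0 hs]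
      _ = _ := by
          rw [← ENNReal.ofReal_pow (Real.exp_pos _).le, ← Real.exp_nat_mul,
            ← ENNReal.ofReal_mul (Real.exp_pos _).le, ← Real.exp_add]
          ring_nf
  refine (measure_mono fun a ha => ?_).trans
    (measure_lt_le_of_subgamma (by fun_prop) (Nat.cast_pos.2 hd) ht hmgf)
  simp only [Set.mem_ofPred_eq] at ha ⊢
  rw [lt_sub_iff_add_lt, lt_div_iff₀' hv]
  linarith

theorem measure_lt_norm_sq_le [SFinite ν] (h : IsSubgaussian ν w v) (hw : Measurable w)
    (hv : 0 ≤ v) {t : ℝ} (ht : 0 ≤ t) :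
    ν {a | v * (Module.finrank ℝ E + 2 * √(Module.finrank ℝ E * t) + 2 * t) < ‖w a‖ ^ 2} ≤
      ENNReal.ofReal (Real.exp (-t)) := by
  obtain ⟨c, hc⟩ : ∃ c : ℝ, c = Module.finrank ℝ E + 2 * √(Module.finrank ℝ E * t) + 2 * t :=
    ⟨_, rfl⟩
  have hlim (a : α) (ha : v * c < ‖w a‖ ^ 2) :
      ∃ k : ℕ, (v + 1 / (k + 1)) * c < ‖w a‖ ^ 2 := by
    have htend := ((tendsto_one_div_add_atTop_nhds_zero_nat (𝕜 := ℝ)).const_add v).mul_const c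
    rw [add_zero] at htend
    exact (htend.eventually_lt_const ha).exists
  have hmono : Monotone fun k : ℕ => {a | (v + 1 / (k + 1)) * c < ‖w a‖ ^ 2} :=
    fun k m hkm a ha => by
      have hc0 : 0 ≤ c := by rw [hc]; positivity
      have hle : (v + 1 / (m + 1)) * c ≤ (v + 1 / (k + 1)) * c := by gcongr
      exact hle.trans_lt ha
  rw [← hc]
  calc ν {a | v * c < ‖w a‖ ^ 2} ≤ ν (⋃ k : ℕ, {a | (v + 1 / (k + 1)) * c < ‖w a‖ ^ 2}) :=
        measure_mono fun a ha => Set.mem_iUnion.2 (hlim a ha)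
    _ = ⨆ k : ℕ, ν {a | (v + 1 / (k + 1)) * c < ‖w a‖ ^ 2} := hmono.measure_iUnion
    _ ≤ _ := iSup_le fun k => by
        have hk : (0 : ℝ) < 1 / (k + 1) := by positivity
        rw [hc]
        exact (h.mono (by linarith)).measure_lt_norm_sq_le_of_pos hw (by linarith) ht

end IsSubgaussian

/-! ### Sums of squares of subgaussian variables -/

theorem exp_sub_one_sub_id_mul_le {c y : ℝ} (hc : |c| ≤ 1) (hy : 0 ≤ y) :
    Real.exp (c * y) - 1 - c * y ≤ c ^ 2 * (Real.exp y - 1 - y) := by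
  have hasSum_exp (x : ℝ) : HasSum (fun k : ℕ => x ^ (k + 2) / ((k + 2).factorial : ℝ))
      (Real.exp x - 1 - x) := by
    have hsum := NormedSpace.expSeries_div_hasSum_exp (𝔸 := ℝ) x
    rw [← Real.exp_eq_exp_ℝ, ← hasSum_nat_add_iff' 2] at hsum
    simpa [Finset.sum_range_succ, sub_sub] using hsum
  refine hasSum_le (fun k => ?_) (hasSum_exp (c * y)) ((hasSum_exp y).mul_left (c ^ 2))
  have hpow : c ^ (k + 2) ≤ c ^ 2 :=
    calc c ^ (k + 2) ≤ |c| ^ (k + 2) := (le_abs_self _).trans_eq (abs_pow _ _)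
      _ ≤ |c| ^ 2 := pow_le_pow_of_le_one (abs_nonneg c) hc (by omega)
      _ = c ^ 2 := sq_abs c
  rw [mul_pow, ← mul_div_assoc]
  gcongr

theorem lintegral_exp_mul_sub_integral_le {α : Type*} [MeasurableSpace α] {ν : Measure α}
    [IsProbabilityMeasure ν] {Y : α → ℝ} (hY : 0 ≤ Y) (hYi : Integrable Y ν)
    (hexp : Integrable (fun a => Real.exp (Y a)) ν) {c : ℝ} (hc : |c| ≤ 1) :
    ∫⁻ a, ENNReal.ofReal (Real.exp (c * (Y a - ∫ b, Y b ∂ν))) ∂ν ≤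
      ENNReal.ofReal (Real.exp (c ^ 2 * ∫ a, (Real.exp (Y a) - 1 - Y a) ∂ν)) := by
  obtain ⟨m, hm⟩ : ∃ m, m = ∫ b, Y b ∂ν := ⟨_, rfl⟩
  have hlin : Integrable (fun a => 1 + c * Y a) ν := (integrable_const _).add (hYi.const_mul c)
  have hrem : Integrable (fun a => c ^ 2 * (Real.exp (Y a) - 1 - Y a)) ν :=
    ((hexp.sub (integrable_const 1)).sub hYi).const_mul _
  have hdom : Integrable (fun a => Real.exp (-(c * m)) *
      (1 + c * Y a + c ^ 2 * (Real.exp (Y a) - 1 - Y a))) ν := (hlin.add hrem).const_mul _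
  have hle (a : α) : Real.exp (c * (Y a - m)) ≤
      Real.exp (-(c * m)) * (1 + c * Y a + c ^ 2 * (Real.exp (Y a) - 1 - Y a)) := by
    rw [mul_sub, sub_eq_neg_add, Real.exp_add]
    gcongr
    linarith [exp_sub_one_sub_id_mul_le hc (hY a)]
  rw [← hm]
  calc ∫⁻ a, ENNReal.ofReal (Real.exp (c * (Y a - m))) ∂ν
      ≤ ∫⁻ a, ENNReal.ofReal (Real.exp (-(c * m)) *
          (1 + c * Y a + c ^ 2 * (Real.exp (Y a) - 1 - Y a))) ∂ν :=
        lintegral_mono fun a => ENNReal.ofReal_le_ofReal (hle a)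
    _ = ENNReal.ofReal (Real.exp (-(c * m)) *
          (1 + c * m + c ^ 2 * ∫ a, (Real.exp (Y a) - 1 - Y a) ∂ν)) := by
        rw [← ofReal_integral_eq_lintegral_ofReal hdom
          (.of_forall fun a => (Real.exp_pos _).le.trans (hle a)), integral_const_mul,
          integral_add hlin hrem, integral_add (integrable_const _) (hYi.const_mul c),
          integral_const_mul, integral_const_mul, ← hm]
        simp
    _ ≤ ENNReal.ofReal (Real.exp (-(c * m)) *
          Real.exp (c * m + c ^ 2 * ∫ a, (Real.exp (Y a) - 1 - Y a) ∂ν)) := by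
        gcongr
        rw [add_assoc, add_comm 1]
        exact Real.add_one_le_exp _
    _ = _ := by rw [← Real.exp_add, neg_add_cancel_left]

namespace IsSubgaussian

variable {α : Type*} [MeasurableSpace α] {ν : Measure α} {Z : α → ℝ} {v : ℝ}

section SFinite

variable [SFinite ν]

theorem lintegral_exp_mul_sq_le (h : IsSubgaussian ν Z v) (hZ : Measurable Z) {l : ℝ} (hl : 0 ≤ l)
    (hlv : l * v < 1 / 2) :
    ∫⁻ a, ENNReal.ofReal (Real.exp (l * Z a ^ 2)) ∂ν ≤ ENNReal.ofReal (√(1 - 2 * (l * v))⁻¹) := by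
  simpa using h.lintegral_exp_mul_norm_sq_le hZ hl hlv

theorem integrable_exp_mul_sq (h : IsSubgaussian ν Z v) (hZ : Measurable Z) {l : ℝ} (hl : 0 ≤ l)
    (hlv : l * v < 1 / 2) : Integrable (fun a => Real.exp (l * Z a ^ 2)) ν :=
  (lintegral_ofReal_ne_top_iff_integrable (by fun_prop) (.of_forall fun _ => (Real.exp_pos _).le)).1
    ((h.lintegral_exp_mul_sq_le hZ hl hlv).trans_lt ENNReal.ofReal_lt_top).ne

theorem integral_exp_mul_sq_le (h : IsSubgaussian ν Z v) (hZ : Measurable Z) {l : ℝ} (hl : 0 ≤ l)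
    (hlv : l * v < 1 / 2) : ∫ a, Real.exp (l * Z a ^ 2) ∂ν ≤ √(1 - 2 * (l * v))⁻¹ := by
  have hle := h.lintegral_exp_mul_sq_le hZ hl hlv
  rw [← ofReal_integral_eq_lintegral_ofReal (h.integrable_exp_mul_sq hZ hl hlv)
    (.of_forall fun _ => (Real.exp_pos _).le)] at hle
  exact (ENNReal.ofReal_le_ofReal_iff (by positivity)).1 hle

theorem integrable_sq (h : IsSubgaussian ν Z v) (hZ : Measurable Z) (hv : 0 < v) :
    Integrable (fun a => Z a ^ 2) ν := by
  have hexp := h.integrable_exp_mul_sq hZ (l := 1 / (4 * v)) (by positivity)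
    (by field_simp; norm_num)
  refine (hexp.const_mul (4 * v)).mono' (by fun_prop) (.of_forall fun a => ?_)
  have hle := (lt_add_one _).le.trans (Real.add_one_le_exp (1 / (4 * v) * Z a ^ 2))
  calc ‖Z a ^ 2‖ = 4 * v * (1 / (4 * v) * Z a ^ 2) := by
        rw [Real.norm_of_nonneg (sq_nonneg _)]
        field_simp
    _ ≤ 4 * v * Real.exp (1 / (4 * v) * Z a ^ 2) := by gcongr

end SFinite

variable [IsProbabilityMeasure ν]

theorem integral_exp_sub_one_sub_le_of_le (h : IsSubgaussian ν Z v) (hZ : Measurable Z) (hv : 0 < v)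
    {l r : ℝ} (hl : 0 ≤ l) (hlr : l ≤ r) (hr : 0 < r) (hrv : r * v < 1 / 2) :
    ∫ a, (Real.exp (l * Z a ^ 2) - 1 - l * Z a ^ 2) ∂ν ≤
      (l / r) ^ 2 * (√(1 - 2 * (r * v))⁻¹ - 1) := by
  have hlv : l * v < 1 / 2 := (mul_le_mul_of_nonneg_right hlr hv.le).trans_lt hrv
  have hexp := h.integrable_exp_mul_sq hZ hr.le hrv
  have hle (a : α) : Real.exp (l * Z a ^ 2) - 1 - l * Z a ^ 2 ≤
      (l / r) ^ 2 * (Real.exp (r * Z a ^ 2) - 1) := by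
    have hc : |l / r| ≤ 1 := by
      rw [abs_of_nonneg (by positivity)]
      exact div_le_one_of_le₀ hlr hr.le
    have hnonneg : 0 ≤ r * Z a ^ 2 := by positivity
    have hscale := exp_sub_one_sub_id_mul_le hc hnonneg
    have hlr' : l / r * (r * Z a ^ 2) = l * Z a ^ 2 := by field_simp
    rw [hlr'] at hscale
    refine hscale.trans ?_
    gcongr ?_ * ?_
    linarith
  calc ∫ a, (Real.exp (l * Z a ^ 2) - 1 - l * Z a ^ 2) ∂ν
      ≤ ∫ a, (l / r) ^ 2 * (Real.exp (r * Z a ^ 2) - 1) ∂ν :=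
        integral_mono (((h.integrable_exp_mul_sq hZ hl hlv).sub (integrable_const _)).sub
          ((h.integrable_sq hZ hv).const_mul l)) ((hexp.sub (integrable_const _)).const_mul _) hle
    _ = (l / r) ^ 2 * (∫ a, Real.exp (r * Z a ^ 2) ∂ν - 1) := by
        rw [integral_const_mul, integral_sub hexp (integrable_const _)]
        simp
    _ ≤ _ := by
        gcongr
        exact h.integral_exp_mul_sq_le hZ hr.le hrv

theorem integral_exp_sub_one_sub_le (h : IsSubgaussian ν Z v) (hZ : Measurable Z) (hv : 0 < v)
    {s : ℝ} (h0 : 0 ≤ s) (hs : s < 1 / 2) :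
    ∫ a, (Real.exp (s / v * Z a ^ 2) - 1 - s / v * Z a ^ 2) ∂ν ≤ 8 * s ^ 2 / (1 - 2 * s) := by
  have hs1 : 0 < 1 - 2 * s := by linarith
  have hone : 1 ≤ (1 - 2 * s)⁻¹ := (one_le_inv₀ hs1).2 (by linarith)
  have hbound (r : ℝ) (hsr : s ≤ r) (hr : 0 < r) (hr2 : r < 1 / 2) :
      ∫ a, (Real.exp (s / v * Z a ^ 2) - 1 - s / v * Z a ^ 2) ∂ν ≤
        (s / r) ^ 2 * (√(1 - 2 * r)⁻¹ - 1) := by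
    have hrv : r / v * v = r := div_mul_cancel₀ r hv.ne'
    have hle := h.integral_exp_sub_one_sub_le_of_le hZ hv (l := s / v) (r := r / v)
      (by positivity) (by gcongr) (by positivity) (by rwa [hrv])
    rwa [hrv, div_div_div_cancel_right₀ hv.ne'] at hle
  -- At `r = 3 / 8` the square root is `2`; beyond `3 / 8` already `8 s ^ 2 ≥ 1`.
  rcases le_or_gt s (3 / 8) with h38 | h38
  · have hsqrt : √(1 - 2 * (3 / 8 : ℝ))⁻¹ = 2 := by
      rw [show (1 - 2 * (3 / 8 : ℝ))⁻¹ = 2 ^ 2 by norm_num, Real.sqrt_sq (by norm_num)]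
    have hle := hbound (3 / 8) h38 (by norm_num) (by norm_num)
    rw [hsqrt] at hle
    refine hle.trans ?_
    rw [div_eq_mul_inv (8 * s ^ 2)]
    nlinarith [mul_le_mul_of_nonneg_left hone (sq_nonneg s)]
  · have hsqrt : √(1 - 2 * s)⁻¹ ≤ (1 - 2 * s)⁻¹ :=
      Real.sqrt_le_iff.2 ⟨by positivity, le_self_pow₀ hone two_ne_zero⟩
    have hle := hbound s le_rfl (by linarith) hs
    rw [div_self (by linarith), one_pow, one_mul] at hle
    refine hle.trans ?_
    have hlarge : 1 * (1 - 2 * s)⁻¹ ≤ 8 * s ^ 2 * (1 - 2 * s)⁻¹ := by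
      gcongr
      nlinarith
    rw [div_eq_mul_inv]
    linarith

theorem lintegral_exp_sq_sub_integral_le (h : IsSubgaussian ν Z v) (hZ : Measurable Z) (hv : 0 < v)
    {s c : ℝ} (h0 : 0 ≤ s) (hs : s < 1 / 2) (hc : |c| ≤ 1) :
    ∫⁻ a, ENNReal.ofReal (Real.exp (s * (c * (Z a ^ 2 - ∫ b, Z b ^ 2 ∂ν) / v))) ∂ν ≤
      ENNReal.ofReal (Real.exp (8 * s ^ 2 / (1 - 2 * s))) := by
  have hexp := h.integrable_exp_mul_sq hZ (l := s / v) (by positivity)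
    (by rwa [div_mul_cancel₀ s hv.ne'])
  have hle := lintegral_exp_mul_sub_integral_le (fun a => show 0 ≤ s / v * Z a ^ 2 by positivity)
    ((h.integrable_sq hZ hv).const_mul (s / v)) hexp hc
  have hnonneg : 0 ≤ ∫ a, (Real.exp (s / v * Z a ^ 2) - 1 - s / v * Z a ^ 2) ∂ν :=
    integral_nonneg fun a => by
      change 0 ≤ _
      linarith [Real.add_one_le_exp (s / v * Z a ^ 2)]
  simp only [integral_const_mul] at hle
  calc ∫⁻ a, ENNReal.ofReal (Real.exp (s * (c * (Z a ^ 2 - ∫ b, Z b ^ 2 ∂ν) / v))) ∂ν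
      = ∫⁻ a, ENNReal.ofReal (Real.exp (c * (s / v * Z a ^ 2 - s / v * ∫ b, Z b ^ 2 ∂ν))) ∂ν := by
        refine lintegral_congr fun a => ?_
        congr 2
        ring
    _ ≤ _ := hle
    _ ≤ _ := by
        gcongr
        calc c ^ 2 * ∫ a, (Real.exp (s / v * Z a ^ 2) - 1 - s / v * Z a ^ 2) ∂ν
            ≤ 1 * ∫ a, (Real.exp (s / v * Z a ^ 2) - 1 - s / v * Z a ^ 2) ∂ν := by
              gcongr
              exact (sq_le_one_iff_abs_le_one c).2 hc
          _ ≤ _ := (one_mul _).trans_le (h.integral_exp_sub_one_sub_le hZ hv h0 hs)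

variable {ι : Type*} [Fintype ι] [Nonempty ι]

theorem measure_lt_sum_sq_sub_integral_le (h : IsSubgaussian ν Z v) (hZ : Measurable Z) (hv : 0 < v)
    {c : ℝ} (hc : |c| ≤ 1) {t : ℝ} (ht : 0 ≤ t) :
    Measure.pi (fun _ : ι => ν) {z | v * (2 * √(8 * Fintype.card ι * t) + 2 * t) <
        c * ∑ i, (Z (z i) ^ 2 - ∫ a, Z a ^ 2 ∂ν)} ≤ ENNReal.ofReal (Real.exp (-t)) := by
  have hsum (z : ι → α) : c * ∑ i, (Z (z i) ^ 2 - ∫ a, Z a ^ 2 ∂ν) =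
      v * ∑ i, c * (Z (z i) ^ 2 - ∫ a, Z a ^ 2 ∂ν) / v := by
    rw [Finset.mul_sum, ← Finset.sum_div, mul_div_cancel₀ _ hv.ne']
  simp only [hsum, mul_lt_mul_iff_right₀ hv]
  refine measure_lt_le_of_subgamma (by fun_prop) (by positivity) ht fun s h0 hs => ?_
  simp only [Finset.mul_sum]
  rw [lintegral_pi_exp_sum _ (f := fun _ a => s * (c * (Z a ^ 2 - ∫ b, Z b ^ 2 ∂ν) / v))
    fun _ => by fun_prop, Finset.prod_const, Finset.card_univ]
  calc _ ≤ ENNReal.ofReal (Real.exp (8 * s ^ 2 / (1 - 2 * s))) ^ Fintype.card ι := by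
        gcongr
        exact h.lintegral_exp_sq_sub_integral_le hZ hv h0 hs hc
    _ = _ := by
        rw [← ENNReal.ofReal_pow (Real.exp_pos _).le, ← Real.exp_nat_mul]
        congr 2
        ring

theorem measure_lt_abs_sum_sq_sub_integral_le (h : IsSubgaussian ν Z v) (hZ : Measurable Z)
    (hv : 0 < v) {t : ℝ} (ht : 0 ≤ t) :
    Measure.pi (fun _ : ι => ν) {z | v * (2 * √(8 * Fintype.card ι * t) + 2 * t) <
        |∑ i, (Z (z i) ^ 2 - ∫ a, Z a ^ 2 ∂ν)|} ≤ ENNReal.ofReal (2 * Real.exp (-t)) := by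
  simp only [lt_abs, Set.ofPred_or]
  refine (measure_union_le _ _).trans ?_
  rw [two_mul (Real.exp _), ENNReal.ofReal_add (Real.exp_pos _).le (Real.exp_pos _).le]
  gcongr
  · simpa using h.measure_lt_sum_sq_sub_integral_le (ι := ι) hZ hv (c := 1) (by simp) ht
  · simpa using h.measure_lt_sum_sq_sub_integral_le (ι := ι) hZ hv (c := -1) (by simp) ht

end IsSubgaussian

/-! ### Nets of the unit sphere -/

section Net

open InnerProductSpace Metric
open scoped NNReal

section NormedSpace

variable {E : Type*} [NormedAddCommGroup E] [NormedSpace ℝ E] [FiniteDimensional ℝ E]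
  {ε : ℝ≥0}

/-- The balls of radius `ε / 2` around the points are disjoint and lie in the ball of radius
`1 + ε / 2`, so the bound follows by comparing volumes. -/
theorem card_le_of_isSeparated_closedBall (hε : 0 < ε) {s : Finset E}
    (hs : (s : Set E) ⊆ closedBall 0 1) (hsep : IsSeparated ε (s : Set E)) :
    (s.card : ℝ) ≤ (1 + 2 / ε) ^ Module.finrank ℝ E := by
  borelize E
  let μ : Measure E := Measure.addHaar
  have hε' : (0 : ℝ) < ε := hε
  have hdisj : (s : Set E).Pairwise (Function.onFun Disjoint fun c => ball c (ε / 2)) :=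
    fun c hc d hd hcd => ball_disjoint_ball <| by
      have hlt : (ε : ENNReal) < edist c d := hsep hc hd hcd
      rw [edist_nndist, ENNReal.coe_lt_coe] at hlt
      rw [add_halves]
      exact_mod_cast hlt.le
  have hsub : ⋃ c ∈ s, ball c (ε / 2 : ℝ) ⊆ ball 0 (1 + ε / 2) :=
    Set.iUnion₂_subset fun c hc => ball_subset_ball' <| by
      rw [add_comm]
      gcongr
      exact hs hc
  have hvol : (s.card : ENNReal) * ENNReal.ofReal ((ε / 2) ^ Module.finrank ℝ E) * μ (ball 0 1) ≤
      ENNReal.ofReal ((1 + ε / 2) ^ Module.finrank ℝ E) * μ (ball 0 1) :=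
    calc (s.card : ENNReal) * ENNReal.ofReal ((ε / 2) ^ Module.finrank ℝ E) * μ (ball 0 1)
        = μ (⋃ c ∈ s, ball c (ε / 2)) := by
          rw [measure_biUnion_finset hdisj fun c _ => measurableSet_ball]
          simp only [μ.addHaar_ball_of_pos _ (half_pos hε'), Finset.sum_const, nsmul_eq_mul,
            mul_assoc]
      _ ≤ μ (ball 0 (1 + ε / 2)) := measure_mono hsub
      _ = _ := μ.addHaar_ball_of_pos _ (by positivity)
  have hcard := ENNReal.toReal_le_of_le_ofReal (by positivity)
    ((ENNReal.mul_le_mul_iff_left (measure_ball_pos μ _ zero_lt_one).ne'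
      measure_ball_lt_top.ne).1 hvol)
  rw [ENNReal.toReal_mul, ENNReal.toReal_natCast, ENNReal.toReal_ofReal (by positivity),
    ← le_div_iff₀ (by positivity), ← div_pow] at hcard
  have hratio : (1 + ε / 2) / (ε / 2 : ℝ) = 1 + 2 / ε := by
    field_simp
    ring
  rwa [hratio] at hcard

theorem packingNumber_le_of_subset_closedBall (hε : 0 < ε) {A : Set E} (hA : A ⊆ closedBall 0 1) :
    packingNumber ε A ≤ ⌊(1 + 2 / ε : ℝ) ^ Module.finrank ℝ E⌋₊ := by
  refine iSup₂_le fun C hCA => iSup_le fun hC => ?_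
  by_contra! hlt
  obtain ⟨t, htC, ht⟩ := Set.exists_subset_encard_eq (Order.add_one_le_of_lt hlt)
  have htfin : t.Finite := Set.finite_of_encard_eq_coe (k := ⌊_⌋₊ + 1) ht
  lift t to Finset E using htfin
  have hle := Nat.le_floor
    (card_le_of_isSeparated_closedBall hε ((htC.trans hCA).trans hA) (hC.subset htC))
  rw [Set.encard_coe_eq_coe_finsetCard, ← Nat.cast_succ, Nat.cast_inj] at ht
  omega

theorem exists_finset_isCover_of_subset_closedBall (hε : 0 < ε) {A : Set E}
    (hA : A ⊆ closedBall 0 1) : ∃ N : Finset E, (N : Set E) ⊆ A ∧ IsCover ε A (N : Set E) ∧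
      (N.card : ℝ) ≤ (1 + 2 / ε) ^ Module.finrank ℝ E := by
  have hle := (coveringNumber_le_packingNumber ε A).trans
    (packingNumber_le_of_subset_closedBall hε hA)
  have hne : coveringNumber ε A ≠ ⊤ := (hle.trans_lt (ENat.natCast_lt_top _)).ne
  obtain ⟨N, hN⟩ := finite_minimalCover (ε := ε) (A := A) |>.exists_finset_coe
  refine ⟨N, hN ▸ minimalCover_subset, hN ▸ isCover_minimalCover hne, ?_⟩
  rw [← encard_minimalCover hne, ← hN, Set.encard_coe_eq_coe_finsetCard, Nat.cast_le] at hle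
  exact (Nat.le_floor_iff (by positivity)).1 hle

end NormedSpace

variable {E : Type*} [NormedAddCommGroup E] [InnerProductSpace ℝ E] {ε : ℝ≥0}

theorem norm_le_of_abs_inner_le_on_sphere {T : E →L[ℝ] E} (hT : T.IsSymmetric) {c : ℝ}
    (hc0 : 0 ≤ c) (hc : ∀ u, ‖u‖ = 1 → |inner ℝ u (T u)| ≤ c) : ‖T‖ ≤ c := by
  rw [T.norm_eq_iSup_rayleighQuotient hT]
  refine ciSup_le fun x => ?_
  rcases eq_or_ne x 0 with rfl | hx
  · simpa using hc0
  · have hunit : ‖‖x‖⁻¹ • x‖ = 1 := by simp [norm_smul, hx]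
    rw [← T.rayleigh_smul x (c := ‖x‖⁻¹) (by simpa using hx), ContinuousLinearMap.rayleighQuotient,
      ContinuousLinearMap.reApplyInnerSelf_apply, hunit, real_inner_comm]
    simpa using hc _ hunit

theorem one_sub_two_mul_norm_le_of_isCover {T : E →L[ℝ] E} (hT : T.IsSymmetric) {N : Set E}
    (hN : N ⊆ closedBall 0 1) (hcov : IsCover ε (sphere 0 1) N) {c : ℝ} (hc0 : 0 ≤ c)
    (hc : ∀ v ∈ N, |inner ℝ v (T v)| ≤ c) : (1 - 2 * ε) * ‖T‖ ≤ c := by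
  have hsphere (u : E) (hu : ‖u‖ = 1) : |inner ℝ u (T u)| ≤ c + 2 * ε * ‖T‖ := by
    obtain ⟨v, hv, hdist⟩ := hcov (mem_sphere_zero_iff_norm.2 hu)
    have huv : ‖u - v‖ ≤ ε := by
      rw [← dist_eq_norm]
      exact_mod_cast edist_le_coe.1 hdist
    have hv1 : ‖v‖ ≤ 1 := mem_closedBall_zero_iff.1 (hN hv)
    have hsplit : inner ℝ u (T u) =
        inner ℝ v (T v) + inner ℝ (u - v) (T u) + inner ℝ v (T (u - v)) := by
      rw [map_sub, inner_sub_left, inner_sub_right]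
      ring
    have hleft : |inner ℝ (u - v) (T u)| ≤ ε * ‖T‖ :=
      calc |inner ℝ (u - v) (T u)| ≤ ‖u - v‖ * (‖T‖ * ‖u‖) :=
            (abs_real_inner_le_norm _ _).trans (by gcongr; exact T.le_opNorm u)
        _ ≤ ε * ‖T‖ := by rw [hu, mul_one]; gcongr
    have hright : |inner ℝ v (T (u - v))| ≤ 1 * (‖T‖ * ε) :=
      (abs_real_inner_le_norm _ _).trans (by gcongr; exact T.le_opNorm_of_le huv)
    rw [hsplit]
    linarith [abs_add_three (inner ℝ v (T v)) (inner ℝ (u - v) (T u)) (inner ℝ v (T (u - v))),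
      hc v hv]
  linarith [norm_le_of_abs_inner_le_on_sphere hT (by positivity) hsphere]

theorem inner_sum_rankOne_apply {ι : Type*} (s : Finset ι) (x : ι → E) (u : E) :
    inner ℝ u ((∑ k ∈ s, rankOne ℝ (x k) (x k)) u) = ∑ k ∈ s, inner ℝ u (x k) ^ 2 := by
  simp [sum_apply, inner_sum, real_inner_smul_right, real_inner_comm, sq]

variable {ι : Type*} [Fintype ι]

theorem abs_sum_inner_sq_sub_le_of_isCover {N : Set E} (hN : N ⊆ sphere 0 1)
    (hcov : IsCover ε (sphere 0 1) N) (x : ι → E) (m : ℝ) {c : ℝ} (hc0 : 0 ≤ c)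
    (hc : ∀ v ∈ N, |∑ k, inner ℝ v (x k) ^ 2 - m| ≤ c) (u : E) :
    (1 - 2 * ε) * |∑ k, inner ℝ u (x k) ^ 2 - m * ‖u‖ ^ 2| ≤ c * ‖u‖ ^ 2 := by
  obtain ⟨T, hT⟩ : ∃ T : E →L[ℝ] E, T = ∑ k, rankOne ℝ (x k) (x k) - m • 1 := ⟨_, rfl⟩
  have hsymm : T.IsSymmetric := by
    rw [hT]
    exact (ContinuousLinearMap.isPositive_sum _ fun k _ =>
      isPositive_rankOne_self (𝕜 := ℝ) (x k)).isSymmetric.sub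
        (LinearMap.IsSymmetric.id.smul (conj_trivial m))
  have hquad (v : E) : inner ℝ v (T v) = ∑ k, inner ℝ v (x k) ^ 2 - m * ‖v‖ ^ 2 := by
    rw [hT, sub_apply, inner_sub_right, inner_sum_rankOne_apply]
    simp [real_inner_smul_right]
  have hT1 := one_sub_two_mul_norm_le_of_isCover hsymm (hN.trans sphere_subset_closedBall) hcov hc0
    fun v hv => by simpa [hquad, mem_sphere_zero_iff_norm.1 (hN hv)] using hc v hv
  rw [← hquad]
  rcases le_total (1 - 2 * (ε : ℝ)) 0 with hε | hε
  · exact (mul_nonpos_of_nonpos_of_nonneg hε (abs_nonneg _)).trans (by positivity)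
  · calc (1 - 2 * ε) * |inner ℝ u (T u)| ≤ (1 - 2 * ε) * (‖u‖ * (‖T‖ * ‖u‖)) := by
          gcongr
          exact (abs_real_inner_le_norm _ _).trans (by gcongr; exact T.le_opNorm u)
      _ = (1 - 2 * ε) * ‖T‖ * ‖u‖ ^ 2 := by ring
      _ ≤ c * ‖u‖ ^ 2 := by gcongr

theorem mul_sqrt_thirty_two_mul_div {n : ℝ} (hn : 0 < n) (t : ℝ) :
    n * √(32 * t / n) = 2 * √(8 * n * t) := by
  rw [← Real.sqrt_sq hn.le, ← Real.sqrt_mul (sq_nonneg n), Real.sqrt_sq hn.le,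
    ← Real.sqrt_sq zero_le_two, ← Real.sqrt_mul (sq_nonneg 2)]
  congr 1
  field_simp
  ring

theorem exists_mem_lt_abs_sum_inner_sq_sub {N : Set E} (hN : N ⊆ sphere 0 1)
    (hcov : IsCover (1 / 20) (sphere 0 1) N) (x : ι → E) {n v t : ℝ} (hn : 0 < n) (hv : 0 < v)
    (ht : 0 ≤ t) {u : E} (hu : ∑ k, inner ℝ u (x k) ^ 2 <
      n * ((1 - 10 * v / 9 * (√(32 * t / n) + 2 * t / n)) * ‖u‖ ^ 2)) :
    ∃ u ∈ N, v * (2 * √(8 * n * t) + 2 * t) < |∑ k, inner ℝ u (x k) ^ 2 - n| := by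
  by_contra! hcon
  have hdev := abs_sum_inner_sq_sub_le_of_isCover hN hcov x n (by positivity) hcon u
  have hfactor : n * ((1 - 10 * v / 9 * (√(32 * t / n) + 2 * t / n)) * ‖u‖ ^ 2) =
      n * ‖u‖ ^ 2 - 10 / 9 * (v * (n * √(32 * t / n) + 2 * t)) * ‖u‖ ^ 2 := by
    field_simp
  rw [hfactor, mul_sqrt_thirty_two_mul_div hn] at hu
  push_cast at hdev
  linarith [neg_abs_le (∑ k, inner ℝ u (x k) ^ 2 - n * ‖u‖ ^ 2)]

variable [FiniteDimensional ℝ E] [MeasurableSpace E] [BorelSpace E] [Nonempty ι] {α : Type*}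
  [MeasurableSpace α] {ν : Measure α} [IsProbabilityMeasure ν] {w : α → E} {v : ℝ}

theorem IsSubgaussian.measure_lt_abs_sum_inner_sq_sub_le (h : IsSubgaussian ν w v)
    (hw : Measurable w) (hv : 0 < v) (hiso : ∀ u, ∫ a, inner ℝ u (w a) ^ 2 ∂ν = ‖u‖ ^ 2) {u : E}
    (hu : ‖u‖ = 1) {t : ℝ} (ht : 0 ≤ t) :
    Measure.pi (fun _ : ι => ν) {z | v * (2 * √(8 * Fintype.card ι * t) + 2 * t) <
        |∑ k, inner ℝ u (w (z k)) ^ 2 - Fintype.card ι|} ≤ ENNReal.ofReal (2 * Real.exp (-t)) := by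
  have hsub := h.inner_left u
  rw [hu, one_pow, mul_one] at hsub
  simpa [hiso, hu, Finset.sum_sub_distrib] using
    hsub.measure_lt_abs_sum_sq_sub_integral_le (ι := ι) (by fun_prop) hv ht

theorem IsSubgaussian.measure_exists_sum_inner_sq_lt_le (h : IsSubgaussian ν w v)
    (hw : Measurable w) (hv : 0 < v) (hiso : ∀ u, ∫ a, inner ℝ u (w a) ^ 2 ∂ν = ‖u‖ ^ 2) {t : ℝ}
    (ht : 0 ≤ t) :
    Measure.pi (fun _ : ι => ν) {z | ∃ u, ∑ k, inner ℝ u (w (z k)) ^ 2 < Fintype.card ι *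
        ((1 - 10 * v / 9 * (√(32 * t / Fintype.card ι) + 2 * t / Fintype.card ι)) * ‖u‖ ^ 2)} ≤
      ENNReal.ofReal (41 ^ Module.finrank ℝ E * (2 * Real.exp (-t))) := by
  obtain ⟨n, hn⟩ : ∃ n : ℝ, n = Fintype.card ι := ⟨_, rfl⟩
  have hn0 : 0 < n := hn ▸ Nat.cast_pos.2 Fintype.card_pos
  obtain ⟨N, hN, hcov, hcard⟩ := exists_finset_isCover_of_subset_closedBall (ε := 1 / 20)
    (by norm_num) (sphere_subset_closedBall (x := (0 : E)) (ε := 1))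
  have hcard : (N.card : ℝ) ≤ 41 ^ Module.finrank ℝ E := hcard.trans_eq (by norm_num)
  have hsub : {z : ι → α | ∃ u, ∑ k, inner ℝ u (w (z k)) ^ 2 <
        n * ((1 - 10 * v / 9 * (√(32 * t / n) + 2 * t / n)) * ‖u‖ ^ 2)} ⊆
      ⋃ u ∈ N, {z | v * (2 * √(8 * n * t) + 2 * t) < |∑ k, inner ℝ u (w (z k)) ^ 2 - n|} := by
    rintro z ⟨u, hu⟩
    simpa using exists_mem_lt_abs_sum_inner_sq_sub hN hcov (fun k => w (z k)) hn0 hv ht hu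
  rw [← hn]
  calc _ ≤ ∑ u ∈ N, Measure.pi (fun _ : ι => ν)
          {z | v * (2 * √(8 * n * t) + 2 * t) < |∑ k, inner ℝ u (w (z k)) ^ 2 - n|} :=
        (measure_mono hsub).trans (measure_biUnion_finset_le _ _)
    _ ≤ ∑ _u ∈ N, ENNReal.ofReal (2 * Real.exp (-t)) := by
        refine Finset.sum_le_sum fun u hu => ?_
        rw [hn]
        exact h.measure_lt_abs_sum_inner_sq_sub_le hw hv hiso
          (mem_sphere_zero_iff_norm.1 (hN hu)) ht
    _ = ENNReal.ofReal (N.card * (2 * Real.exp (-t))) := by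
        rw [ENNReal.ofReal_mul N.card.cast_nonneg]
        simp
    _ ≤ _ := by gcongr

end Net

/-! ### Bernstein's inequality for bounded vectors -/

theorem cosh_sqrt_convex {a b w : ℝ} (ha : 0 ≤ a) (hb : 0 ≤ b) (h0 : 0 ≤ w) (h1 : w ≤ 1) :
    Real.cosh √((1 - w) * a + w * b) ≤ (1 - w) * Real.cosh √a + w * Real.cosh √b := by
  have hasSum_cosh_sqrt (x : ℝ) (hx : 0 ≤ x) :
      HasSum (fun k : ℕ => x ^ k / ((2 * k).factorial : ℝ)) (Real.cosh √x) := by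
    simpa [pow_mul, Real.sq_sqrt hx] using Real.hasSum_cosh √x
  have h1w : 0 ≤ 1 - w := by linarith
  refine hasSum_le (fun k => ?_) (hasSum_cosh_sqrt _ (by positivity))
    (((hasSum_cosh_sqrt a ha).mul_left (1 - w)).add ((hasSum_cosh_sqrt b hb).mul_left w))
  have hconv := (convexOn_pow (𝕜 := ℝ) k).2 ha hb h1w h0 (by ring)
  simp only [smul_eq_mul] at hconv
  rw [← mul_div_assoc, ← mul_div_assoc, ← add_div]
  gcongr

section CoshNorm

open InnerProductGeometry

variable {E : Type*} [NormedAddCommGroup E] [InnerProductSpace ℝ E]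

/-- `‖x + y‖ ^ 2` is the convex combination of `(‖x‖ - ‖y‖) ^ 2` and `(‖x‖ + ‖y‖) ^ 2` with weight
`(1 + cos (angle x y)) / 2`. -/
theorem cosh_norm_add_le_cos_angle (x y : E) :
    Real.cosh ‖x + y‖ ≤ Real.cosh ‖x‖ * Real.cosh ‖y‖ +
      Real.cos (angle x y) * (Real.sinh ‖x‖ * Real.sinh ‖y‖) := by
  have hconv := cosh_sqrt_convex (a := (‖x‖ - ‖y‖) ^ 2) (b := (‖x‖ + ‖y‖) ^ 2)
    (w := (1 + Real.cos (angle x y)) / 2) (sq_nonneg _) (sq_nonneg _)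
    (by linarith [Real.neg_one_le_cos (angle x y)]) (by linarith [Real.cos_le_one (angle x y)])
  have hnorm : (1 - (1 + Real.cos (angle x y)) / 2) * (‖x‖ - ‖y‖) ^ 2 +
      (1 + Real.cos (angle x y)) / 2 * (‖x‖ + ‖y‖) ^ 2 = ‖x + y‖ ^ 2 := by
    rw [norm_add_sq_real, ← cos_angle_mul_norm_mul_norm]
    ring
  rw [hnorm, Real.sqrt_sq (norm_nonneg _), Real.sqrt_sq_eq_abs, Real.cosh_abs,
    Real.sqrt_sq (by positivity), Real.cosh_sub, Real.cosh_add] at hconv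
  linarith

theorem cosh_norm_add_le (x y : E) :
    Real.cosh ‖x + y‖ ≤ Real.cosh ‖x‖ + Real.sinh ‖x‖ / ‖x‖ * inner ℝ x y +
      Real.cosh ‖x‖ * (Real.exp ‖y‖ - 1 - ‖y‖) := by
  have hinner : Real.sinh ‖x‖ / ‖x‖ * inner ℝ x y =
      Real.cos (angle x y) * Real.sinh ‖x‖ * ‖y‖ := by
    rw [← cos_angle_mul_norm_mul_norm]
    rcases eq_or_ne x 0 with rfl | hx
    · simp
    · field_simp
  have hsinh : 0 ≤ Real.sinh ‖x‖ := Real.sinh_nonneg_iff.2 (norm_nonneg x)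
  have hcos : Real.cos (angle x y) * Real.sinh ‖x‖ ≤ Real.cosh ‖x‖ :=
    (mul_le_of_le_one_left hsinh (Real.cos_le_one _)).trans (Real.sinh_lt_cosh _).le
  have hself : 0 ≤ Real.sinh ‖y‖ - ‖y‖ := sub_nonneg.2 (Real.self_le_sinh_iff.2 (norm_nonneg y))
  rw [hinner, ← Real.cosh_add_sinh ‖y‖]
  linarith [cosh_norm_add_le_cos_angle x y, mul_le_mul_of_nonneg_right hcos hself]

end CoshNorm

section Bernstein

theorem integrable_norm_sq_of_bound {α E : Type*} [MeasurableSpace α] {ν : Measure α}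
    [IsFiniteMeasure ν] [NormedAddCommGroup E] {f : α → E} {M : ℝ} (hf : AEStronglyMeasurable f ν)
    (hM : ∀ᵐ a ∂ν, ‖f a‖ ≤ M) :
    Integrable (fun a => ‖f a‖ ^ 2) ν := by
  refine .of_bound (hf.norm.pow 2) (M ^ 2) ?_
  filter_upwards [hM] with a ha
  rw [Real.norm_of_nonneg (by positivity)]
  gcongr

variable {α : Type*} [MeasurableSpace α] {ν : Measure α} [IsProbabilityMeasure ν]
  {E : Type*} [NormedAddCommGroup E] [InnerProductSpace ℝ E] [MeasurableSpace E] [BorelSpace E]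
  [SecondCountableTopology E] {f : α → E} {M : ℝ}

theorem integrable_const_add_inner_add_norm_sq (hf : Measurable f) (hM : ∀ᵐ a ∂ν, ‖f a‖ ≤ M)
    (s : E) (A B C : ℝ) : Integrable (fun a => A + B * inner ℝ s (f a) + C * ‖f a‖ ^ 2) ν :=
  have hfi : Integrable f ν := .of_bound hf.aestronglyMeasurable M hM
  ((integrable_const _).add ((hfi.const_inner s).const_mul _)).add
    ((integrable_norm_sq_of_bound hf.aestronglyMeasurable hM).const_mul _)

variable [CompleteSpace E]

theorem integral_const_add_inner_add_norm_sq (hf : Measurable f) (hM : ∀ᵐ a ∂ν, ‖f a‖ ≤ M)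
    (h0 : ∫ a, f a ∂ν = 0) (s : E) (A B C : ℝ) :
    ∫ a, (A + B * inner ℝ s (f a) + C * ‖f a‖ ^ 2) ∂ν = A + C * ∫ a, ‖f a‖ ^ 2 ∂ν := by
  have hfi : Integrable f ν := .of_bound hf.aestronglyMeasurable M hM
  have hinner : Integrable (fun a => B * inner ℝ s (f a)) ν := (hfi.const_inner s).const_mul _
  have hlin : Integrable (fun a => A + B * inner ℝ s (f a)) ν := (integrable_const _).add hinner
  rw [integral_add hlin ((integrable_norm_sq_of_bound hf.aestronglyMeasurable hM).const_mul _),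
    integral_add (integrable_const _) hinner, integral_const_mul, integral_const_mul,
    integral_inner hfi, h0]
  simp

theorem lintegral_cosh_norm_add_le (hf : Measurable f) (hM : ∀ᵐ a ∂ν, ‖f a‖ ≤ M)
    (h0 : ∫ a, f a ∂ν = 0) {θ : ℝ} (hθ : 0 ≤ θ) (hθM : θ * M ≤ 1) (s : E) :
    ∫⁻ a, ENNReal.ofReal (Real.cosh (θ * ‖s + f a‖)) ∂ν ≤
      ENNReal.ofReal (Real.exp ((∫ a, ‖f a‖ ^ 2 ∂ν) * θ ^ 2) * Real.cosh (θ * ‖s‖)) := by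
  obtain ⟨c, hc⟩ : ∃ c, c = Real.sinh (θ * ‖s‖) / (θ * ‖s‖) := ⟨_, rfl⟩
  obtain ⟨C, hC⟩ : ∃ C, C = Real.cosh (θ * ‖s‖) := ⟨_, rfl⟩
  have hC0 : 0 ≤ C := hC ▸ (Real.cosh_pos _).le
  have hnorm (x : E) : ‖θ • x‖ = θ * ‖x‖ := by rw [norm_smul, Real.norm_of_nonneg hθ]
  have hle : ∀ᵐ a ∂ν, Real.cosh (θ * ‖s + f a‖) ≤
      C + c * θ ^ 2 * inner ℝ s (f a) + C * θ ^ 2 * ‖f a‖ ^ 2 := by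
    filter_upwards [hM] with a ha
    have hcosh := cosh_norm_add_le (θ • s) (θ • f a)
    rw [← smul_add, hnorm, hnorm, hnorm, ← hC, ← hc, real_inner_smul_left,
      real_inner_smul_right] at hcosh
    have hsmall : |θ * ‖f a‖| ≤ 1 := by
      rw [abs_of_nonneg (by positivity)]
      exact (mul_le_mul_of_nonneg_left ha hθ).trans hθM
    have hexp := (le_abs_self _).trans (Real.abs_exp_sub_one_sub_id_le hsmall)
    linarith [mul_le_mul_of_nonneg_left hexp hC0]
  calc ∫⁻ a, ENNReal.ofReal (Real.cosh (θ * ‖s + f a‖)) ∂ν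
      ≤ ∫⁻ a, ENNReal.ofReal (C + c * θ ^ 2 * inner ℝ s (f a) + C * θ ^ 2 * ‖f a‖ ^ 2) ∂ν :=
        lintegral_mono_ae (hle.mono fun _ h => ENNReal.ofReal_le_ofReal h)
    _ = ENNReal.ofReal (C + C * θ ^ 2 * ∫ a, ‖f a‖ ^ 2 ∂ν) := by
        rw [← ofReal_integral_eq_lintegral_ofReal
          (integrable_const_add_inner_add_norm_sq hf hM s _ _ _)
          (hle.mono fun _ h => (Real.cosh_pos _).le.trans h),
          integral_const_add_inner_add_norm_sq hf hM h0]
    _ ≤ _ := by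
        rw [← hC]
        gcongr
        linarith [mul_le_mul_of_nonneg_right
          (Real.add_one_le_exp ((∫ a, ‖f a‖ ^ 2 ∂ν) * θ ^ 2)) hC0]

theorem lintegral_cosh_norm_sum_le (hf : Measurable f) (hM : ∀ᵐ a ∂ν, ‖f a‖ ≤ M)
    (h0 : ∫ a, f a ∂ν = 0) {θ : ℝ} (hθ : 0 ≤ θ) (hθM : θ * M ≤ 1) (n : ℕ) :
    ∫⁻ z, ENNReal.ofReal (Real.cosh (θ * ‖∑ k, f (z k)‖)) ∂Measure.pi (fun _ : Fin n => ν) ≤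
      ENNReal.ofReal (Real.exp (n * ((∫ a, ‖f a‖ ^ 2 ∂ν) * θ ^ 2))) := by
  obtain ⟨v, hv⟩ : ∃ v, v = ∫ a, ‖f a‖ ^ 2 ∂ν := ⟨_, rfl⟩
  have _ := Real.continuous_cosh.measurable
  have hpotential := lintegral_potential_sum_le ν (p := fun _ : E => True)
    (Φ := fun k s => ENNReal.ofReal (Real.exp (k * (v * θ ^ 2)) * Real.cosh (θ * ‖s‖)))
    (fun k => by fun_prop) hf (fun _ _ _ => trivial) (fun k s _ => ?_) n (s := 0) trivial
  · simpa [hv] using hpotential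
  · simp only [ENNReal.ofReal_mul (Real.exp_pos _).le]
    rw [lintegral_const_mul _ (by fun_prop)]
    refine (mul_le_mul_right (lintegral_cosh_norm_add_le hf hM h0 hθ hθM s) _).trans_eq ?_
    rw [← ENNReal.ofReal_mul (Real.exp_pos _).le, ← ENNReal.ofReal_mul (Real.exp_pos _).le,
      ← mul_assoc, ← Real.exp_add, ← hv]
    congr 3
    push_cast
    ring

theorem measure_lt_norm_sum_le (hf : Measurable f) (hM : ∀ᵐ a ∂ν, ‖f a‖ ≤ M)
    (h0 : ∫ a, f a ∂ν = 0) {θ : ℝ} (hθ : 0 ≤ θ) (hθM : θ * M ≤ 1) (n : ℕ) (r : ℝ) :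
    Measure.pi (fun _ : Fin n => ν) {z | r < ‖∑ k, f (z k)‖} ≤
      ENNReal.ofReal (Real.exp (Real.log 2 + n * (∫ a, ‖f a‖ ^ 2 ∂ν) * θ ^ 2 - θ * r)) := by
  refine measure_lt_le_of_lintegral_exp_le (by fun_prop) hθ ?_
  have _ := Real.continuous_cosh.measurable
  calc ∫⁻ z, ENNReal.ofReal (Real.exp (θ * ‖∑ k, f (z k)‖)) ∂Measure.pi (fun _ : Fin n => ν)
      ≤ ∫⁻ z, ENNReal.ofReal (2 * Real.cosh (θ * ‖∑ k, f (z k)‖))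
          ∂Measure.pi (fun _ : Fin n => ν) := by
        refine lintegral_mono fun z => ENNReal.ofReal_le_ofReal ?_
        rw [Real.cosh_eq]
        linarith [Real.exp_pos (-(θ * ‖∑ k, f (z k)‖))]
    _ ≤ ENNReal.ofReal 2 * ENNReal.ofReal (Real.exp (n * ((∫ a, ‖f a‖ ^ 2 ∂ν) * θ ^ 2))) := by
        simp only [ENNReal.ofReal_mul zero_le_two]
        rw [lintegral_const_mul _ (by fun_prop)]
        gcongr
        exact lintegral_cosh_norm_sum_le hf hM h0 hθ hθM n
    _ = _ := by
        rw [← ENNReal.ofReal_mul zero_le_two, Real.exp_add, Real.exp_log two_pos, mul_assoc]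

theorem lintegral_norm_sum_sq_le (hf : Measurable f) (hM : ∀ᵐ a ∂ν, ‖f a‖ ≤ M)
    (h0 : ∫ a, f a ∂ν = 0) (n : ℕ) :
    ∫⁻ z, ENNReal.ofReal (‖∑ k, f (z k)‖ ^ 2) ∂Measure.pi (fun _ : Fin n => ν) ≤
      ENNReal.ofReal (n * ∫ a, ‖f a‖ ^ 2 ∂ν) := by
  obtain ⟨v, hv⟩ : ∃ v, v = ∫ a, ‖f a‖ ^ 2 ∂ν := ⟨_, rfl⟩
  have hv0 : 0 ≤ v := hv ▸ integral_nonneg fun _ => sq_nonneg _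
  have hpotential := lintegral_potential_sum_le ν (p := fun _ : E => True)
    (Φ := fun k s => ENNReal.ofReal (‖s‖ ^ 2 + k * v)) (fun k => by fun_prop) hf
    (fun _ _ _ => trivial) (fun k s _ => ?_) n (s := 0) trivial
  · simpa [hv] using hpotential
  · have hexpand (a : α) : ‖s + f a‖ ^ 2 + k * v =
        (‖s‖ ^ 2 + k * v) + 2 * inner ℝ s (f a) + 1 * ‖f a‖ ^ 2 := by
      rw [norm_add_sq_real]
      ring
    have hint := integrable_const_add_inner_add_norm_sq hf hM s (‖s‖ ^ 2 + k * v) 2 1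
    simp only [← hexpand] at hint
    rw [← ofReal_integral_eq_lintegral_ofReal hint (.of_forall fun _ => by positivity)]
    simp only [hexpand]
    rw [integral_const_add_inner_add_norm_sq hf hM h0, ← hv]
    refine ENNReal.ofReal_le_ofReal (le_of_eq ?_)
    push_cast
    ring

theorem measure_mul_lt_norm_sum_sq_le (hf : Measurable f) (hM : ∀ᵐ a ∂ν, ‖f a‖ ≤ M)
    (h0 : ∫ a, f a ∂ν = 0) (n : ℕ) {a : ℝ} (ha : 0 < a) :
    Measure.pi (fun _ : Fin n => ν) {z | a * (n * ∫ a, ‖f a‖ ^ 2 ∂ν) < ‖∑ k, f (z k)‖ ^ 2} ≤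
      ENNReal.ofReal a⁻¹ := by
  have hsq := lintegral_norm_sum_sq_le hf hM h0 n
  have hmeas : Measurable fun z : Fin n → α => ENNReal.ofReal (‖∑ k, f (z k)‖ ^ 2) := by fun_prop
  have hw0 : 0 ≤ n * ∫ a, ‖f a‖ ^ 2 ∂ν :=
    mul_nonneg (Nat.cast_nonneg n) (integral_nonneg fun _ => sq_nonneg _)
  obtain ⟨w, hw⟩ : ∃ w, w = n * ∫ a, ‖f a‖ ^ 2 ∂ν := ⟨_, rfl⟩
  rw [← hw] at hsq hw0 ⊢
  rcases hw0.eq_or_lt with rfl | hw0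
  · rw [ENNReal.ofReal_zero, nonpos_iff_eq_zero, lintegral_eq_zero_iff hmeas] at hsq
    refine (measure_mono_null (fun z hz => ?_) hsq).trans_le zero_le
    simpa [sq_pos_iff] using hz
  · calc _ ≤ Measure.pi (fun _ : Fin n => ν)
            {z | ENNReal.ofReal (a * w) ≤ ENNReal.ofReal (‖∑ k, f (z k)‖ ^ 2)} :=
          measure_mono fun z hz => ENNReal.ofReal_le_ofReal (le_of_lt hz)
      _ ≤ ENNReal.ofReal w / ENNReal.ofReal (a * w) :=
          (meas_ge_le_lintegral_div hmeas.aemeasurable (by simpa using mul_pos ha hw0)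
            ENNReal.ofReal_ne_top).trans (by gcongr)
      _ = _ := by
          rw [← ENNReal.ofReal_div_of_pos (by positivity)]
          congr 1
          field_simp

theorem exists_bernstein_parameter {w M t : ℝ} (hw : 0 < w) (hM : 0 ≤ M) (ht : 0 < t) :
    ∃ θ, 0 ≤ θ ∧ θ * M ≤ 1 ∧
      3 / 2 * t + w * θ ^ 2 ≤ θ * √(4 * w * (1 + 8 * t) + 3 * M ^ 2 * t ^ 2) := by
  rcases le_or_gt w (8 * M ^ 2 * t) with hwM | hwM
  · have hM0 : 0 < M := hM.lt_of_ne fun h => by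
      simp only [← h] at hwM
      linarith
    refine ⟨M⁻¹, by positivity, (inv_mul_cancel₀ hM0.ne').le, ?_⟩
    have hsq : (w / M) ^ 2 ≤ 8 * w * t := by
      rw [div_pow, div_le_iff₀ (by positivity)]
      nlinarith
    calc 3 / 2 * t + w * M⁻¹ ^ 2 = M⁻¹ * (w / M + 3 / 2 * M * t) := by
          field_simp
          ring
      _ ≤ _ := by
          gcongr
          refine Real.le_sqrt_of_sq_le ?_
          have hexpand : (w / M + 3 / 2 * M * t) ^ 2 =
              (w / M) ^ 2 + 3 * w * t + 9 / 4 * M ^ 2 * t ^ 2 := by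
            field_simp
            ring
          nlinarith [mul_pos hw ht, sq_nonneg (M * t)]
  · have hθ : √(8 * t / w) ^ 2 = 8 * t / w := Real.sq_sqrt (by positivity)
    refine ⟨√(8 * t / w), Real.sqrt_nonneg _, ?_, ?_⟩
    · refine (sq_le_one_iff₀ (by positivity)).1 ?_
      rw [mul_pow, hθ, div_mul_eq_mul_div, div_le_one hw]
      linarith
    · have hlarge : 16 * t ≤ √(8 * t / w) * √(4 * w * (1 + 8 * t) + 3 * M ^ 2 * t ^ 2) := by
        rw [← Real.sqrt_mul (by positivity)]
        refine Real.le_sqrt_of_sq_le ?_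
        rw [div_mul_eq_mul_div, le_div_iff₀ hw]
        nlinarith [mul_pos hw ht, mul_nonneg ht.le (sq_nonneg (M * t)),
          mul_pos (mul_pos hw ht) ht]
      rw [hθ, mul_div_cancel₀ _ hw.ne']
      linarith

theorem measure_lt_norm_sum_sq_le (hf : Measurable f) (hM0 : 0 ≤ M) (hM : ∀ᵐ a ∂ν, ‖f a‖ ≤ M)
    (h0 : ∫ a, f a ∂ν = 0) (n : ℕ) {t : ℝ} (ht : 0 ≤ t) :
    Measure.pi (fun _ : Fin n => ν)
      {z | 4 * (n * ∫ a, ‖f a‖ ^ 2 ∂ν) * (1 + 8 * t) + 3 * M ^ 2 * t ^ 2 < ‖∑ k, f (z k)‖ ^ 2} ≤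
      ENNReal.ofReal (Real.exp (-t)) := by
  obtain ⟨w, hw⟩ : ∃ w, w = n * ∫ a, ‖f a‖ ^ 2 ∂ν := ⟨_, rfl⟩
  have hw0 : 0 ≤ w :=
    hw ▸ mul_nonneg (Nat.cast_nonneg n) (integral_nonneg fun _ => sq_nonneg _)
  rw [← hw]
  -- For small `t` Markov's inequality for the second moment already suffices.
  rcases le_or_gt (Real.exp t * w) (4 * w * (1 + 8 * t)) with hle | hgt
  · rw [Real.exp_neg]
    refine (measure_mono fun z hz => ?_).trans
      (measure_mul_lt_norm_sum_sq_le hf hM h0 n (Real.exp_pos t))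
    simp only [Set.mem_ofPred_eq] at hz ⊢
    rw [← hw]
    exact (hle.trans (le_add_of_nonneg_right (by positivity))).trans_lt hz
  · have hwpos : 0 < w := hw0.lt_of_ne fun h => by simp [← h] at hgt
    have hexp : 4 * (1 + 8 * t) < Real.exp t := by
      refine lt_of_mul_lt_mul_right ?_ hw0
      linarith
    have htpos : 0 < t := ht.lt_of_ne fun h => by norm_num [← h] at hexp
    have hlog : 2 * Real.log 2 ≤ t := by
      rw [← Real.exp_le_exp, two_mul, Real.exp_add, Real.exp_log two_pos]
      linarith
    obtain ⟨θ, hθ, hθM, hbound⟩ := exists_bernstein_parameter hwpos hM0 htpos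
    calc _ ≤ Measure.pi (fun _ : Fin n => ν)
            {z | √(4 * w * (1 + 8 * t) + 3 * M ^ 2 * t ^ 2) < ‖∑ k, f (z k)‖} :=
          measure_mono fun z hz => by simpa using Real.sqrt_lt_sqrt (by positivity) hz
      _ ≤ _ := measure_lt_norm_sum_le hf hM h0 hθ hθM n _
      _ ≤ _ := by
          rw [← hw]
          gcongr
          linarith

end Bernstein

/-! ### The Golden–Thompson inequality for rank-one perturbations -/

section GoldenThompson

open InnerProductSpace

theorem sum_mul_mul_sum_mul_le_of_monovary {ι : Type*} [Fintype ι] {p f g : ι → ℝ}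
    (hp : ∀ i, 0 ≤ p i) (hsum : ∑ i, p i = 1) (hfg : Monovary f g) :
    (∑ i, p i * f i) * ∑ i, p i * g i ≤ ∑ i, p i * (f i * g i) := by
  have hnonneg : 0 ≤ ∑ i, ∑ j, p i * p j * ((f j - f i) * (g j - g i)) :=
    Finset.sum_nonneg fun i _ => Finset.sum_nonneg fun j _ =>
      mul_nonneg (mul_nonneg (hp i) (hp j)) (monovary_iff_forall_mul_nonneg.1 hfg i j)
  have hexpand : ∑ i, ∑ j, p i * p j * ((f j - f i) * (g j - g i)) =
      (∑ i, p i) * (∑ j, p j * (f j * g j)) + (∑ i, p i * (f i * g i)) * (∑ j, p j) -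
        (∑ i, p i * f i) * (∑ j, p j * g j) - (∑ i, p i * g i) * (∑ j, p j * f j) := by
    simp only [Finset.sum_mul_sum, ← Finset.sum_add_distrib, ← Finset.sum_sub_distrib]
    exact Finset.sum_congr rfl fun i _ => Finset.sum_congr rfl fun j _ => by ring
  rw [hexpand, hsum, mul_comm (∑ i, p i * g i)] at hnonneg
  linarith

variable {E : Type*} [NormedAddCommGroup E] [InnerProductSpace ℝ E]

theorem pow_apply_of_apply_eq_smul {T : E →L[ℝ] E} {v : E} {l : ℝ} (h : T v = l • v) (k : ℕ) :
    (T ^ k) v = l ^ k • v := by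
  induction k with
  | zero => simp
  | succ k ih => rw [pow_succ, mul_apply_eq_comp, h, map_smul, ih, smul_smul, ← pow_succ']

theorem inner_apply_self_eq_sum {ι : Type*} [Fintype ι] (b : OrthonormalBasis ι ℝ E)
    {T : E →L[ℝ] E} {l : ι → ℝ} (h : ∀ i, T (b i) = l i • b i) (u : E) :
    inner ℝ u (T u) = ∑ i, inner ℝ (b i) u ^ 2 * l i := by
  have hT : T u = ∑ i, (inner ℝ (b i) u * l i) • b i := by
    conv_lhs => rw [← b.sum_repr' u]
    simp only [map_sum, map_smul, h, smul_smul]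
  rw [hT, inner_sum]
  refine Finset.sum_congr rfl fun i _ => ?_
  rw [real_inner_smul_right, real_inner_comm]
  ring

theorem norm_sq_eq_sum_inner_sq {ι : Type*} [Fintype ι] (b : OrthonormalBasis ι ℝ E) (u : E) :
    ‖u‖ ^ 2 = ∑ i, inner ℝ (b i) u ^ 2 := by
  simpa using (b.sum_sq_norm_inner_right u).symm

theorem eigenvalue_nonneg_of_isPositive {H : E →L[ℝ] E} (hH : H.IsPositive) {ι : Type*}
    [Fintype ι] (b : OrthonormalBasis ι ℝ E) {l : ι → ℝ} (h : ∀ i, H (b i) = l i • b i)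
    (i : ι) : 0 ≤ l i := by
  simpa [h, real_inner_smul_right] using hH.inner_nonneg_right (b i)

/-- The trace exponential `tr (exp T)`, the potential function of the matrix Chernoff bound. -/
noncomputable def traceExp (T : E →L[ℝ] E) : ℝ :=
  LinearMap.trace ℝ E (NormedSpace.exp T : E →L[ℝ] E)

theorem traceExp_eq_sum {ι : Type*} [Fintype ι] (b : OrthonormalBasis ι ℝ E) (T : E →L[ℝ] E) :
    traceExp T = ∑ i, inner ℝ (b i) (NormedSpace.exp T (b i)) :=
  LinearMap.trace_eq_sum_inner _ b

variable [FiniteDimensional ℝ E]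

theorem exists_eigenbasis {T : E →L[ℝ] E} (hT : IsSelfAdjoint T) :
    ∃ (b : OrthonormalBasis (Fin (Module.finrank ℝ E)) ℝ E) (l : Fin (Module.finrank ℝ E) → ℝ),
      ∀ i, T (b i) = l i • b i :=
  ⟨hT.isSymmetric.eigenvectorBasis rfl, hT.isSymmetric.eigenvalues rfl,
    hT.isSymmetric.apply_eigenvectorBasis rfl⟩

theorem exp_apply_of_apply_eq_smul {T : E →L[ℝ] E} {v : E} {l : ℝ} (h : T v = l • v) :
    NormedSpace.exp T v = Real.exp l • v := by
  have hT := (ContinuousLinearMap.apply ℝ E v).hasSum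
    (NormedSpace.exp_series_hasSum_exp' (𝕂 := ℝ) T)
  have hl := (NormedSpace.exp_series_hasSum_exp' (𝕂 := ℝ) l).smul_const v
  rw [← Real.exp_eq_exp_ℝ] at hl
  refine hT.unique ?_
  convert hl using 2 with k
  simp [pow_apply_of_apply_eq_smul h, smul_smul]

theorem hasSum_inner_exp (T : E →L[ℝ] E) (u : E) :
    HasSum (fun k : ℕ => (k.factorial : ℝ)⁻¹ * inner ℝ u ((T ^ k) u))
      (inner ℝ u (NormedSpace.exp T u)) := by
  simpa [real_inner_smul_right] using ((innerSL ℝ u).comp (ContinuousLinearMap.apply ℝ E u)).hasSum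
    (NormedSpace.exp_series_hasSum_exp' (𝕂 := ℝ) T)

theorem exp_add_smul_one (T : E →L[ℝ] E) (c : ℝ) :
    NormedSpace.exp (T + c • 1) = Real.exp c • NormedSpace.exp T := by
  let _ : NormedAlgebra ℚ (E →L[ℝ] E) := NormedAlgebra.restrictScalars ℚ ℝ _
  rw [NormedSpace.exp_add_of_commute ((Commute.one_right T).smul_right c)]
  ext v
  simp [exp_apply_of_apply_eq_smul (T := c • (1 : E →L[ℝ] E)) (v := v) (l := c) (by simp)]

theorem isSelfAdjoint_rankOne_self (x : E) : IsSelfAdjoint (rankOne ℝ x x) :=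
  (isPositive_rankOne_self x).isSelfAdjoint

theorem isSelfAdjoint_smul_add {S T : E →L[ℝ] E} (hS : IsSelfAdjoint S) (c : ℝ)
    (hT : IsSelfAdjoint T) : IsSelfAdjoint (S + c • T) :=
  hS.add ((IsSelfAdjoint.all c).smul hT)

section Positive

variable {H : E →L[ℝ] E}

theorem inner_pow_apply_self_nonneg (hH : H.IsPositive) (u : E) (k : ℕ) :
    0 ≤ inner ℝ u ((H ^ k) u) := by
  obtain ⟨b, l, hb⟩ := exists_eigenbasis hH.isSelfAdjoint
  rw [inner_apply_self_eq_sum b fun i => pow_apply_of_apply_eq_smul (hb i) k]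
  exact Finset.sum_nonneg fun i _ =>
    mul_nonneg (sq_nonneg _) (pow_nonneg (eigenvalue_nonneg_of_isPositive hH b hb i) k)

theorem inner_pow_mul_inner_pow_le (hH : H.IsPositive) {u : E} (hu : ‖u‖ = 1) {h : ℝ} (hh : 0 ≤ h)
    (j k : ℕ) :
    inner ℝ u ((H ^ j) u) * inner ℝ u (((H + h • 1) ^ k) u) ≤
      inner ℝ u ((H ^ j * (H + h • 1) ^ k) u) := by
  obtain ⟨b, l, hb⟩ := exists_eigenbasis hH.isSelfAdjoint
  have hl := eigenvalue_nonneg_of_isPositive hH b hb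
  have hpow (i) : (H ^ j) (b i) = l i ^ j • b i := pow_apply_of_apply_eq_smul (hb i) j
  have hpow' (i) : ((H + h • 1) ^ k) (b i) = (l i + h) ^ k • b i :=
    pow_apply_of_apply_eq_smul (by simp [hb, add_smul]) k
  have hmul (i) : (H ^ j * (H + h • 1) ^ k) (b i) = (l i ^ j * (l i + h) ^ k) • b i := by
    rw [mul_apply_eq_comp, hpow', map_smul, hpow, smul_smul, mul_comm]
  rw [inner_apply_self_eq_sum b hpow, inner_apply_self_eq_sum b hpow',
    inner_apply_self_eq_sum b hmul]
  refine sum_mul_mul_sum_mul_le_of_monovary (fun _ => sq_nonneg _)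
    (by rw [← norm_sq_eq_sum_inner_sq, hu, one_pow]) fun i i' hlt => ?_
  have hll : l i + h < l i' + h := lt_of_pow_lt_pow_left₀ k (by linarith [hl i']) hlt
  exact pow_le_pow_left₀ (hl i) (by linarith) j

theorem inner_pow_mul_add_rankOne_pow_le (hH : H.IsPositive) {u : E} (hu : ‖u‖ = 1) {h : ℝ}
    (hh : 0 ≤ h) (j k : ℕ) :
    inner ℝ u ((H ^ j * (H + h • rankOne ℝ u u) ^ k) u) ≤
      inner ℝ u ((H ^ j * (H + h • 1) ^ k) u) := by
  induction k generalizing j with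
  | zero => simp
  | succ k ih =>
    have hleft : inner ℝ u ((H ^ j * (H + h • rankOne ℝ u u) ^ (k + 1)) u) =
        inner ℝ u ((H ^ (j + 1) * (H + h • rankOne ℝ u u) ^ k) u) +
          h * (inner ℝ u ((H ^ j) u) * inner ℝ u (((H + h • rankOne ℝ u u) ^ k) u)) := by
      rw [pow_succ' (H + h • rankOne ℝ u u) k, pow_succ H j]
      simp only [mul_apply_eq_comp, add_apply, map_add, inner_add_right, smul_apply,
        rankOne_apply, map_smul, real_inner_smul_right]
      ring
    have hright : inner ℝ u ((H ^ j * (H + h • 1) ^ (k + 1)) u) =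
        inner ℝ u ((H ^ (j + 1) * (H + h • 1) ^ k) u) +
          h * inner ℝ u ((H ^ j * (H + h • 1) ^ k) u) := by
      rw [pow_succ' (H + h • 1) k, pow_succ H j]
      simp only [mul_apply_eq_comp, add_apply, map_add, inner_add_right, smul_apply,
        one_apply_eq_self, map_smul, real_inner_smul_right]
    rw [hleft, hright]
    gcongr
    · exact ih (j + 1)
    · refine le_trans ?_ (inner_pow_mul_inner_pow_le hH hu hh j k)
      gcongr
      · exact inner_pow_apply_self_nonneg hH u j
      · simpa using ih 0

end Positive

theorem isPositive_add_norm_smul_one {A : E →L[ℝ] E} (hA : IsSelfAdjoint A) :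
    (A + ‖A‖ • 1).IsPositive := by
  refine ⟨(isSelfAdjoint_smul_add hA ‖A‖ (.one _)).isSymmetric, fun v => ?_⟩
  have hinner : -(‖A‖ * ‖v‖ * ‖v‖) ≤ inner ℝ (A v) v :=
    (neg_le_neg (by gcongr; exact A.le_opNorm v)).trans
      (neg_le_of_abs_le (abs_real_inner_le_norm (A v) v))
  rw [ContinuousLinearMap.reApplyInnerSelf_apply, add_apply, smul_apply, one_apply_eq_self,
    inner_add_left, real_inner_smul_left, real_inner_self_eq_norm_mul_norm, RCLike.re_to_real]
  linarith

theorem inner_exp_add_rankOne_le {A : E →L[ℝ] E} (hA : IsSelfAdjoint A) {u : E} (hu : ‖u‖ = 1)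
    {h : ℝ} (hh : 0 ≤ h) :
    inner ℝ u (NormedSpace.exp (A + h • rankOne ℝ u u) u) ≤
      Real.exp h * inner ℝ u (NormedSpace.exp A u) := by
  obtain ⟨H, c, hH, hAH⟩ : ∃ (H : E →L[ℝ] E) (c : ℝ), H.IsPositive ∧ A = H + c • 1 :=
    ⟨A + ‖A‖ • 1, -‖A‖, isPositive_add_norm_smul_one hA, by module⟩
  have hpos : inner ℝ u (NormedSpace.exp (H + h • rankOne ℝ u u) u) ≤
      inner ℝ u (NormedSpace.exp (H + h • 1) u) := by
    refine hasSum_le (fun k => ?_) (hasSum_inner_exp _ u) (hasSum_inner_exp _ u)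
    gcongr
    simpa using inner_pow_mul_add_rankOne_pow_le hH hu hh 0 k
  rw [hAH, add_right_comm, exp_add_smul_one, exp_add_smul_one]
  rw [exp_add_smul_one] at hpos
  simp only [smul_apply, real_inner_smul_right] at hpos ⊢
  linarith [mul_le_mul_of_nonneg_left hpos (Real.exp_pos c).le]

theorem exp_mul_add_inner_sub_le_inner_exp {T : E →L[ℝ] E} (hT : IsSelfAdjoint T) (c : ℝ) (v : E) :
    Real.exp c * (‖v‖ ^ 2 + (inner ℝ v (T v) - c * ‖v‖ ^ 2)) ≤
      inner ℝ v (NormedSpace.exp T v) := by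
  obtain ⟨b, l, hb⟩ := exists_eigenbasis hT
  rw [inner_apply_self_eq_sum b hb, norm_sq_eq_sum_inner_sq b,
    inner_apply_self_eq_sum b fun i => exp_apply_of_apply_eq_smul (hb i), Finset.mul_sum,
    ← Finset.sum_sub_distrib, ← Finset.sum_add_distrib, Finset.mul_sum]
  refine Finset.sum_le_sum fun i _ => ?_
  have htangent : Real.exp c * (1 + (l i - c)) ≤ Real.exp (l i) := by
    rw [← add_sub_cancel c (l i), Real.exp_add, add_sub_cancel_left, add_comm (1 : ℝ)]
    gcongr
    exact Real.add_one_le_exp _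
  linarith [mul_le_mul_of_nonneg_left htangent (sq_nonneg (inner ℝ (b i) v))]

theorem continuous_traceExp : Continuous (traceExp : (E →L[ℝ] E) → ℝ) := by
  let _ : NormedAlgebra ℚ (E →L[ℝ] E) := NormedAlgebra.restrictScalars ℚ ℝ _
  exact (LinearMap.continuous_of_finiteDimensional
    (LinearMap.trace ℝ E ∘ₗ ContinuousLinearMap.coeLM ℝ)).comp NormedSpace.exp_continuous

theorem traceExp_eq_sum_exp {ι : Type*} [Fintype ι] (b : OrthonormalBasis ι ℝ E) {T : E →L[ℝ] E}
    {l : ι → ℝ} (h : ∀ i, T (b i) = l i • b i) : traceExp T = ∑ i, Real.exp (l i) := by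
  rw [traceExp_eq_sum b]
  simp [exp_apply_of_apply_eq_smul (h _), real_inner_smul_right]

theorem traceExp_nonneg {T : E →L[ℝ] E} (hT : IsSelfAdjoint T) : 0 ≤ traceExp T := by
  obtain ⟨b, l, hb⟩ := exists_eigenbasis hT
  rw [traceExp_eq_sum_exp b hb]
  positivity

theorem traceExp_zero : traceExp (0 : E →L[ℝ] E) = Module.finrank ℝ E := by
  simp [traceExp]

theorem traceExp_add_mul_inner_exp_le {A : E →L[ℝ] E} (hA : IsSelfAdjoint A) (u : E) (h : ℝ) :
    traceExp A + h * inner ℝ u (NormedSpace.exp A u) ≤ traceExp (A + h • rankOne ℝ u u) := by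
  obtain ⟨b, l, hb⟩ := exists_eigenbasis hA
  rw [traceExp_eq_sum_exp b hb, traceExp_eq_sum b,
    inner_apply_self_eq_sum b fun i => exp_apply_of_apply_eq_smul (hb i), Finset.mul_sum,
    ← Finset.sum_add_distrib]
  refine Finset.sum_le_sum fun i _ => ?_
  have hconv := exp_mul_add_inner_sub_le_inner_exp
    (isSelfAdjoint_smul_add hA h (isSelfAdjoint_rankOne_self u)) (l i) (b i)
  have hinner : inner ℝ (b i) ((A + h • rankOne ℝ u u) (b i)) = l i + h * inner ℝ (b i) u ^ 2 := by
    simp [hb, inner_add_right, real_inner_smul_right, real_inner_comm u, sq]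
  rw [hinner, b.norm_eq_one] at hconv
  linarith

theorem traceExp_add_one_sub_exp_neg_mul_le {A : E →L[ℝ] E} (hA : IsSelfAdjoint A) {u : E}
    (hu : ‖u‖ = 1) {s : ℝ} (hs : 0 ≤ s) :
    traceExp A + (1 - Real.exp (-s)) * inner ℝ u (NormedSpace.exp (A + s • rankOne ℝ u u) u) ≤
      traceExp (A + s • rankOne ℝ u u) := by
  obtain ⟨c, hc⟩ : ∃ c, c = Real.exp (-s) *
    inner ℝ u (NormedSpace.exp (A + s • rankOne ℝ u u) u) := ⟨_, rfl⟩
  have hself (τ : ℝ) : IsSelfAdjoint (A + τ • rankOne ℝ u u) :=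
    isSelfAdjoint_smul_add hA τ (isSelfAdjoint_rankOne_self u)
  have hquad {τ : ℝ} (hτ : τ ≤ s) :
      Real.exp τ * c ≤ inner ℝ u (NormedSpace.exp (A + τ • rankOne ℝ u u) u) := by
    have hle := inner_exp_add_rankOne_le (hself τ) hu (sub_nonneg.2 hτ)
    rw [add_assoc, ← add_smul, add_sub_cancel] at hle
    refine (mul_le_mul_of_nonneg_left hle (Real.exp_pos (τ - s)).le).trans' ?_ |>.trans_eq ?_
    · rw [hc, ← mul_assoc, ← Real.exp_add, sub_eq_add_neg]
    · rw [← mul_assoc, ← Real.exp_add, sub_add_sub_cancel, sub_self, Real.exp_zero, one_mul]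
  have hslope {τ z : ℝ} (hτz : τ < z) (hτ : τ ≤ s) :
      slope (fun τ => -traceExp (A + τ • rankOne ℝ u u)) τ z ≤ -(Real.exp τ * c) := by
    have hklein := traceExp_add_mul_inner_exp_le (hself τ) u (z - τ)
    rw [add_assoc, ← add_smul, add_sub_cancel] at hklein
    rw [slope_def_field, div_le_iff₀ (sub_pos.2 hτz)]
    linarith [mul_le_mul_of_nonneg_left (hquad hτ) (sub_pos.2 hτz).le]
  have hderiv (τ : ℝ) : HasDerivAt (fun τ => -traceExp A - (Real.exp τ - 1) * c)
      (-(Real.exp τ * c)) τ :=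
    (((Real.hasDerivAt_exp τ).sub_const 1).mul_const c).const_sub _
  have hbound := image_le_of_liminf_slope_right_le_deriv_boundary
    (f := fun τ => -traceExp (A + τ • rankOne ℝ u u)) (a := 0) (b := s)
    ((continuous_traceExp.comp (by fun_prop)).neg.continuousOn) (by simp)
    (fun τ _ => (hderiv τ).continuousAt.continuousWithinAt)
    (fun τ _ => (hderiv τ).hasDerivWithinAt)
    (fun τ hτ r hr => Filter.Eventually.frequently
      (eventually_mem_nhdsWithin.mono fun z hz => (hslope hz hτ.2.le).trans_lt hr)) ⟨hs, le_rfl⟩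
  have hexp : (Real.exp s - 1) * Real.exp (-s) = 1 - Real.exp (-s) := by
    rw [sub_mul, ← Real.exp_add, add_neg_cancel, Real.exp_zero, one_mul]
  rw [hc, ← mul_assoc, hexp] at hbound
  linarith

end GoldenThompson

/-! ### The matrix Chernoff bound for rank-one summands -/

section MatrixChernoff

open InnerProductSpace

theorem one_sub_exp_neg_mul_div_mul_le {θ r R : ℝ} (hr : 0 ≤ r) (hrR : r ≤ R) (hR : 0 < R) :
    (1 - Real.exp (-(θ * R))) / R * r ≤ 1 - Real.exp (-(θ * r)) := by
  have h := convexOn_exp.2 (Set.mem_univ (-(θ * R))) (Set.mem_univ 0)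
    (div_nonneg hr hR.le) (sub_nonneg.2 ((div_le_one hR).2 hrR)) (by ring)
  have harg : r / R * -(θ * R) = -(θ * r) := by field_simp
  simp only [smul_eq_mul, Real.exp_zero, mul_zero, add_zero, mul_one, harg] at h
  have hleft : (1 - Real.exp (-(θ * R))) / R * r = r / R - r / R * Real.exp (-(θ * R)) := by
    field_simp
  linarith

theorem exp_neg_le_quadratic {x : ℝ} (hx : 0 ≤ x) : Real.exp (-x) ≤ 1 - x + x ^ 2 / 2 := by
  rw [Real.exp_neg]
  refine (inv_anti₀ (by positivity) (Real.quadratic_le_exp_of_nonneg hx)).trans ?_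
  rw [inv_le_iff_one_le_mul₀ (by positivity)]
  nlinarith [sq_nonneg (x ^ 2)]

theorem chernoff_exponent_le {ε R : ℝ} (hε : 0 ≤ ε) (hR : 0 < R) :
    ε / R * (1 - ε) - (1 - Real.exp (-(ε / R * R))) / R ≤ -(ε ^ 2 / (2 * R)) := by
  rw [div_mul_cancel₀ ε hR.ne', div_mul_eq_mul_div, ← sub_div, ← div_div, ← neg_div]
  gcongr
  linarith [exp_neg_le_quadratic hε]

variable {E : Type*} [NormedAddCommGroup E] [InnerProductSpace ℝ E]

theorem continuous_rankOne_self : Continuous fun x : E => rankOne ℝ x x :=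
  (rankOne ℝ).continuous.clm_apply continuous_id

variable {α : Type*} [MeasurableSpace α] {ν : Measure α} {w : α → E}

theorem integrable_inner_apply_self {ι : Type*} [Fintype ι] (b : OrthonormalBasis ι ℝ E)
    {T : E →L[ℝ] E} {l : ι → ℝ} (h : ∀ i, T (b i) = l i • b i)
    (hint : ∀ u, Integrable (fun a => inner ℝ u (w a) ^ 2) ν) :
    Integrable (fun a => inner ℝ (w a) (T (w a))) ν := by
  simp only [inner_apply_self_eq_sum b h]
  exact integrable_finsetSum _ fun i _ => (hint (b i)).mul_const _

theorem integral_inner_apply_self {ι : Type*} [Fintype ι] (b : OrthonormalBasis ι ℝ E)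
    {T : E →L[ℝ] E} {l : ι → ℝ} (h : ∀ i, T (b i) = l i • b i)
    (hint : ∀ u, Integrable (fun a => inner ℝ u (w a) ^ 2) ν)
    (hiso : ∀ u : E, ∫ a, inner ℝ u (w a) ^ 2 ∂ν = ‖u‖ ^ 2) :
    ∫ a, inner ℝ (w a) (T (w a)) ∂ν = ∑ i, l i := by
  simp only [inner_apply_self_eq_sum b h]
  rw [integral_finsetSum _ fun i _ => (hint (b i)).mul_const _]
  simp [integral_mul_const, hiso]

variable [FiniteDimensional ℝ E]

theorem inner_exp_apply_self_nonneg {T : E →L[ℝ] E} (hT : IsSelfAdjoint T) (u : E) :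
    0 ≤ inner ℝ u (NormedSpace.exp T u) := by
  obtain ⟨b, l, hb⟩ := exists_eigenbasis hT
  rw [inner_apply_self_eq_sum b fun i => exp_apply_of_apply_eq_smul (hb i)]
  positivity

theorem traceExp_neg_smul_add_rankOne_le {S : E →L[ℝ] E} (hS : IsSelfAdjoint S) {x : E} {R θ : ℝ}
    (hR : 0 < R) (hx : ‖x‖ ^ 2 ≤ R) (hθ : 0 ≤ θ) :
    traceExp (-θ • (S + rankOne ℝ x x)) ≤ traceExp (-θ • S) -
      (1 - Real.exp (-(θ * R))) / R * inner ℝ x (NormedSpace.exp (-θ • S) x) := by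
  rcases eq_or_ne x 0 with rfl | hx0
  · simp
  obtain ⟨r, u, hu, rfl⟩ : ∃ (r : ℝ) (u : E), ‖u‖ = 1 ∧ x = r • u :=
    ⟨‖x‖, ‖x‖⁻¹ • x, norm_smul_inv_norm hx0, (smul_inv_smul₀ (norm_ne_zero_iff.2 hx0) x).symm⟩
  rw [norm_smul, hu, mul_one, Real.norm_eq_abs, sq_abs] at hx
  have hself : IsSelfAdjoint (-θ • (S + rankOne ℝ (r • u) (r • u))) :=
    (IsSelfAdjoint.all (-θ)).smul (hS.add (isSelfAdjoint_rankOne_self _))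
  have hdrop := traceExp_add_one_sub_exp_neg_mul_le hself hu (s := θ * r ^ 2) (by positivity)
  have hsplit : -θ • (S + rankOne ℝ (r • u) (r • u)) + (θ * r ^ 2) • rankOne ℝ u u = -θ • S := by
    simp only [map_smul, smul_apply]
    module
  rw [hsplit] at hdrop
  have hquad := inner_exp_apply_self_nonneg ((IsSelfAdjoint.all (-θ)).smul hS) u
  have hscale : inner ℝ (r • u) (NormedSpace.exp (-θ • S) (r • u)) =
      r ^ 2 * inner ℝ u (NormedSpace.exp (-θ • S) u) := by
    rw [map_smul, real_inner_smul_left, real_inner_smul_right]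
    ring
  rw [hscale]
  linarith [mul_le_mul_of_nonneg_right (one_sub_exp_neg_mul_div_mul_le (θ := θ) (sq_nonneg r) hx hR)
    hquad]

theorem exp_neg_mul_le_traceExp_of_inner_lt {S : E →L[ℝ] E} (hS : IsSelfAdjoint S) {u : E} {c θ : ℝ}
    (hθ : 0 ≤ θ) (hu : inner ℝ u (S u) < c * ‖u‖ ^ 2) :
    Real.exp (-θ * c) ≤ traceExp (-θ • S) := by
  obtain ⟨b, l, hb⟩ := exists_eigenbasis hS
  rw [inner_apply_self_eq_sum b hb, norm_sq_eq_sum_inner_sq b, Finset.mul_sum] at hu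
  obtain ⟨i, -, hi⟩ := Finset.exists_lt_of_sum_lt hu
  have hli : l i < c := by
    rw [mul_comm] at hi
    exact lt_of_mul_lt_mul_right hi (sq_nonneg _)
  rw [traceExp_eq_sum_exp b (l := fun i => -θ * l i) fun i => by simp [hb, smul_smul]]
  calc Real.exp (-θ * c) ≤ Real.exp (-θ * l i) :=
        Real.exp_le_exp.2 (mul_le_mul_of_nonpos_left hli.le (neg_nonpos.2 hθ))
    _ ≤ ∑ i, Real.exp (-θ * l i) :=
        Finset.single_le_sum (f := fun i => Real.exp (-θ * l i)) (fun i _ => (Real.exp_pos _).le)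
          (Finset.mem_univ i)

variable [MeasurableSpace E] [BorelSpace E]

theorem integrable_inner_sq_of_bound [IsFiniteMeasure ν] (hw : Measurable w) {R : ℝ}
    (hR : ∀ᵐ a ∂ν, ‖w a‖ ^ 2 ≤ R) (u : E) : Integrable (fun a => inner ℝ u (w a) ^ 2) ν := by
  refine .of_bound (by fun_prop) (‖u‖ ^ 2 * R) ?_
  filter_upwards [hR] with a ha
  rw [norm_pow, Real.norm_eq_abs]
  calc |inner ℝ u (w a)| ^ 2 ≤ (‖u‖ * ‖w a‖) ^ 2 := by
        gcongr
        exact abs_real_inner_le_norm u (w a)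
    _ ≤ ‖u‖ ^ 2 * R := by
        rw [mul_pow]
        gcongr

variable [IsProbabilityMeasure ν]

theorem lintegral_traceExp_neg_smul_add_rankOne_le (hw : Measurable w) {R : ℝ} (hR0 : 0 < R)
    (hR : ∀ᵐ a ∂ν, ‖w a‖ ^ 2 ≤ R) (hiso : ∀ u : E, ∫ a, inner ℝ u (w a) ^ 2 ∂ν = ‖u‖ ^ 2)
    {θ : ℝ} (hθ : 0 ≤ θ) {S : E →L[ℝ] E} (hS : IsSelfAdjoint S) :
    ∫⁻ a, ENNReal.ofReal (traceExp (-θ • (S + rankOne ℝ (w a) (w a)))) ∂ν ≤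
      ENNReal.ofReal (Real.exp (-((1 - Real.exp (-(θ * R))) / R))) *
        ENNReal.ofReal (traceExp (-θ • S)) := by
  obtain ⟨κ, hκ⟩ : ∃ κ, κ = (1 - Real.exp (-(θ * R))) / R := ⟨_, rfl⟩
  obtain ⟨b, l, hb⟩ := exists_eigenbasis ((IsSelfAdjoint.all (-θ)).smul hS)
  have hexp (i) := exp_apply_of_apply_eq_smul (hb i)
  have hint := integrable_inner_sq_of_bound hw hR
  have hle : ∀ᵐ a ∂ν, traceExp (-θ • (S + rankOne ℝ (w a) (w a))) ≤
      traceExp (-θ • S) - κ * inner ℝ (w a) (NormedSpace.exp (-θ • S) (w a)) :=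
    hR.mono fun a ha => hκ ▸ traceExp_neg_smul_add_rankOne_le hS hR0 ha hθ
  have hnonneg (a) : 0 ≤ traceExp (-θ • (S + rankOne ℝ (w a) (w a))) :=
    traceExp_nonneg ((IsSelfAdjoint.all (-θ)).smul (hS.add (isSelfAdjoint_rankOne_self _)))
  have hquad := (integrable_inner_apply_self b hexp hint).const_mul κ
  have hdiff : Integrable (fun a => traceExp (-θ • S) -
      κ * inner ℝ (w a) (NormedSpace.exp (-θ • S) (w a))) ν := (integrable_const _).sub hquad
  calc _ ≤ ∫⁻ a, ENNReal.ofReal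
          (traceExp (-θ • S) - κ * inner ℝ (w a) (NormedSpace.exp (-θ • S) (w a))) ∂ν :=
        lintegral_mono_ae (hle.mono fun a h => ENNReal.ofReal_le_ofReal h)
    _ = ENNReal.ofReal ((1 - κ) * traceExp (-θ • S)) := by
        rw [← ofReal_integral_eq_lintegral_ofReal hdiff
          (hle.mono fun a h => (hnonneg a).trans h), integral_sub (integrable_const _) hquad,
          integral_const_mul, integral_inner_apply_self b hexp hint hiso,
          ← traceExp_eq_sum_exp b hb, integral_const, probReal_univ, one_smul, sub_mul, one_mul]
    _ ≤ _ := by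
        rw [← ENNReal.ofReal_mul (Real.exp_pos _).le, ← hκ]
        gcongr
        · exact traceExp_nonneg ((IsSelfAdjoint.all (-θ)).smul hS)
        · exact Real.one_sub_le_exp_neg κ

theorem lintegral_traceExp_neg_smul_sum_rankOne_le (hw : Measurable w) {R : ℝ} (hR0 : 0 < R)
    (hR : ∀ᵐ a ∂ν, ‖w a‖ ^ 2 ≤ R) (hiso : ∀ u : E, ∫ a, inner ℝ u (w a) ^ 2 ∂ν = ‖u‖ ^ 2)
    (n : ℕ) {θ : ℝ} (hθ : 0 ≤ θ) :
    ∫⁻ z, ENNReal.ofReal (traceExp (-θ • ∑ k, rankOne ℝ (w (z k)) (w (z k))))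
        ∂Measure.pi (fun _ : Fin n => ν) ≤
      ENNReal.ofReal (Real.exp (-((1 - Real.exp (-(θ * R))) / R))) ^ n *
        ENNReal.ofReal (Module.finrank ℝ E) := by
  have hcont : Measurable fun T : E →L[ℝ] E => ENNReal.ofReal (traceExp (-θ • T)) :=
    (continuous_traceExp.comp (continuous_const_smul _)).measurable.ennreal_ofReal
  have hrank : Measurable fun a => rankOne ℝ (w a) (w a) :=
    continuous_rankOne_self.measurable.comp hw
  have hpotential := lintegral_potential_sum_le ν (p := fun T : E →L[ℝ] E => IsSelfAdjoint T)
    (Φ := fun k T => ENNReal.ofReal (Real.exp (-((1 - Real.exp (-(θ * R))) / R))) ^ k *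
      ENNReal.ofReal (traceExp (-θ • T)))
    (fun k => hcont.const_mul _) hrank (fun T a hT => hT.add (isSelfAdjoint_rankOne_self (w a)))
    (fun k T hT => ?_) n (s := 0) (.zero _)
  · simpa [traceExp_zero] using hpotential
  · refine (lintegral_const_mul _ (hcont.comp (hrank.const_add T))).trans_le ?_
    rw [pow_succ, mul_assoc]
    gcongr
    exact lintegral_traceExp_neg_smul_add_rankOne_le hw hR0 hR hiso hθ hT

theorem measure_exists_sum_inner_sq_lt_le (hw : Measurable w) {R : ℝ} (hR0 : 0 < R)
    (hR : ∀ᵐ a ∂ν, ‖w a‖ ^ 2 ≤ R) (hiso : ∀ u : E, ∫ a, inner ℝ u (w a) ^ 2 ∂ν = ‖u‖ ^ 2)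
    (n : ℕ) {ε : ℝ} (hε : 0 ≤ ε) :
    Measure.pi (fun _ : Fin n => ν)
        {z | ∃ u : E, ∑ k, inner ℝ u (w (z k)) ^ 2 < n * ((1 - ε) * ‖u‖ ^ 2)} ≤
      ENNReal.ofReal (Module.finrank ℝ E * Real.exp (-(n * ε ^ 2 / (2 * R)))) := by
  obtain ⟨θ, hθ⟩ : ∃ θ, θ = ε / R := ⟨_, rfl⟩
  have hθ0 : 0 ≤ θ := hθ ▸ by positivity
  have hsum (z : Fin n → α) (u : E) :
      inner ℝ u ((∑ k, rankOne ℝ (w (z k)) (w (z k))) u) = ∑ k, inner ℝ u (w (z k)) ^ 2 := by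
    simp [sum_apply, inner_sum, real_inner_smul_right, real_inner_comm u, sq]
  have hmeas : Measurable fun z : Fin n → α =>
      ENNReal.ofReal (traceExp (-θ • ∑ k, rankOne ℝ (w (z k)) (w (z k)))) := by
    have hrank := continuous_rankOne_self (E := E).measurable.comp hw
    exact ((continuous_traceExp.comp (continuous_const_smul _)).measurable.comp
      (Finset.measurable_sum _ fun k _ => hrank.comp (measurable_pi_apply k))).ennreal_ofReal
  calc _ ≤ Measure.pi (fun _ : Fin n => ν) {z | ENNReal.ofReal (Real.exp (-θ * (n * (1 - ε)))) ≤
          ENNReal.ofReal (traceExp (-θ • ∑ k, rankOne ℝ (w (z k)) (w (z k))))} := by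
        refine measure_mono fun z ⟨u, hu⟩ => ENNReal.ofReal_le_ofReal ?_
        rw [← hsum, ← mul_assoc] at hu
        exact exp_neg_mul_le_traceExp_of_inner_lt
          (isSelfAdjoint_sum _ fun k _ => isSelfAdjoint_rankOne_self (w (z k))) hθ0 hu
    _ ≤ (ENNReal.ofReal (Real.exp (-((1 - Real.exp (-(θ * R))) / R))) ^ n *
          ENNReal.ofReal (Module.finrank ℝ E)) / ENNReal.ofReal (Real.exp (-θ * (n * (1 - ε)))) :=
        (meas_ge_le_lintegral_div hmeas.aemeasurable (by simp [Real.exp_pos])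
          ENNReal.ofReal_ne_top).trans
          (by gcongr; exact lintegral_traceExp_neg_smul_sum_rankOne_le hw hR0 hR hiso n hθ0)
    _ = ENNReal.ofReal (Module.finrank ℝ E *
          Real.exp (n * (θ * (1 - ε) - (1 - Real.exp (-(θ * R))) / R))) := by
        rw [← ENNReal.ofReal_pow (Real.exp_pos _).le, ← Real.exp_nat_mul,
          ← ENNReal.ofReal_mul (Real.exp_pos _).le, ← ENNReal.ofReal_div_of_pos (Real.exp_pos _),
          mul_comm, mul_div_assoc, ← Real.exp_sub]
        ring_nf
    _ ≤ _ := by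
        have hexponent := mul_le_mul_of_nonneg_left (chernoff_exponent_le hε hR0)
          (Nat.cast_nonneg (α := ℝ) n)
        rw [mul_neg, ← mul_div_assoc] at hexponent
        rw [hθ]
        gcongr

end MatrixChernoff

/-! ### Square roots of matrices -/

section SquareRoot

open Matrix

section Action

variable {ι : Type*} [Fintype ι] [DecidableEq ι] {M : Matrix ι ι ℝ}

theorem toEuclideanLin_mul_apply (M N : Matrix ι ι ℝ) (v : EuclideanSpace ℝ ι) :
    toEuclideanLin (M * N) v = toEuclideanLin M (toEuclideanLin N v) := by
  rw [toEuclideanLin, toLpLin_mul_same, LinearMap.comp_apply]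

theorem toEuclideanLin_one_apply (v : EuclideanSpace ℝ ι) :
    toEuclideanLin (1 : Matrix ι ι ℝ) v = v := by
  rw [toEuclideanLin, toLpLin_one, LinearMap.id_apply]

theorem inner_toEuclideanLin (hM : M.IsHermitian) (u v : EuclideanSpace ℝ ι) :
    inner ℝ u (toEuclideanLin M v) = inner ℝ (toEuclideanLin M u) v :=
  (isSymmetric_toEuclideanLin_iff.2 hM u v).symm

theorem posSemidef_of_inner_nonneg (hM : M.IsHermitian)
    (h : ∀ v, 0 ≤ inner ℝ v (toEuclideanLin M v)) : M.PosSemidef := by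
  refine .of_dotProduct_mulVec_nonneg hM fun v => (h (.toLp 2 v)).trans_eq ?_
  rw [EuclideanSpace.inner_eq_star_dotProduct, dotProduct_comm]
  simp

theorem posDef_of_inner_pos (hM : M.IsHermitian)
    (h : ∀ v, v ≠ 0 → 0 < inner ℝ v (toEuclideanLin M v)) : M.PosDef := by
  refine .of_dotProduct_mulVec_pos hM fun v hv => (h (.toLp 2 v) ?_).trans_eq ?_
  · simpa using hv
  · rw [EuclideanSpace.inner_eq_star_dotProduct, dotProduct_comm]
    simp

end Action

variable {d : ℕ} {M : Matrix (Fin d) (Fin d) ℝ}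

theorem isHermitian_halfPow (M : Matrix (Fin d) (Fin d) ℝ) : (halfPow M).IsHermitian :=
  (nonneg_iff_posSemidef.1 (CFC.sqrt_nonneg M)).isHermitian

theorem isHermitian_negHalfPow (M : Matrix (Fin d) (Fin d) ℝ) : (negHalfPow M).IsHermitian :=
  (isHermitian_halfPow M).inv

theorem halfPow_mul_self (hM : M.PosSemidef) : halfPow M * halfPow M = M :=
  CFC.sqrt_mul_sqrt_self M hM.nonneg

theorem negHalfPow_mul_self (hM : M.PosSemidef) : negHalfPow M * negHalfPow M = M⁻¹ := by
  rw [negHalfPow, ← Matrix.mul_inv_rev, halfPow_mul_self hM]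

theorem isUnit_det_halfPow_iff (hM : M.PosSemidef) : IsUnit (halfPow M).det ↔ IsUnit M := by
  rw [isUnit_iff_isUnit_det M, ← isUnit_mul_self_iff, ← det_mul, halfPow_mul_self hM]

theorem halfPow_mul_negHalfPow (hM : M.PosSemidef) (hu : IsUnit M) :
    halfPow M * negHalfPow M = 1 :=
  mul_nonsing_inv _ ((isUnit_det_halfPow_iff hM).2 hu)

theorem negHalfPow_mul_halfPow (hM : M.PosSemidef) (hu : IsUnit M) :
    negHalfPow M * halfPow M = 1 :=
  nonsing_inv_mul _ ((isUnit_det_halfPow_iff hM).2 hu)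

theorem negHalfPow_of_not_isUnit (hM : M.PosSemidef) (hu : ¬ IsUnit M) : negHalfPow M = 0 :=
  nonsing_inv_apply_not_isUnit _ (mt (isUnit_det_halfPow_iff hM).1 hu)

theorem toEuclideanLin_halfPow_negHalfPow (hM : M.PosSemidef) (hu : IsUnit M)
    (v : EuclideanSpace ℝ (Fin d)) :
    toEuclideanLin (halfPow M) (toEuclideanLin (negHalfPow M) v) = v := by
  rw [← toEuclideanLin_mul_apply, halfPow_mul_negHalfPow hM hu, toEuclideanLin_one_apply]

theorem toEuclideanLin_negHalfPow_halfPow (hM : M.PosSemidef) (hu : IsUnit M)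
    (v : EuclideanSpace ℝ (Fin d)) :
    toEuclideanLin (negHalfPow M) (toEuclideanLin (halfPow M) v) = v := by
  rw [← toEuclideanLin_mul_apply, negHalfPow_mul_halfPow hM hu, toEuclideanLin_one_apply]

theorem inner_negHalfPow_mul_negHalfPow (hM : M.PosSemidef) (hu : IsUnit M)
    (u v : EuclideanSpace ℝ (Fin d)) :
    inner ℝ (toEuclideanLin (negHalfPow M) u)
      (toEuclideanLin M (toEuclideanLin (negHalfPow M) v)) = inner ℝ u v := by
  nth_rewrite 2 [← halfPow_mul_self hM]
  rw [toEuclideanLin_mul_apply, toEuclideanLin_halfPow_negHalfPow hM hu,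
    inner_toEuclideanLin (isHermitian_halfPow M), toEuclideanLin_halfPow_negHalfPow hM hu]

theorem norm_sq_toEuclideanLin_negHalfPow (hM : M.PosSemidef) (v : EuclideanSpace ℝ (Fin d)) :
    ‖toEuclideanLin (negHalfPow M) v‖ ^ 2 = inner ℝ v (toEuclideanLin M⁻¹ v) := by
  rw [← negHalfPow_mul_self hM, toEuclideanLin_mul_apply,
    inner_toEuclideanLin (isHermitian_negHalfPow M), real_inner_self_eq_norm_sq]

theorem matNorm_eq_norm_halfPow (hM : M.PosSemidef) (v : EuclideanSpace ℝ (Fin d)) :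
    matNorm M v = ‖toEuclideanLin (halfPow M) v‖ := by
  nth_rewrite 1 [matNorm, ← halfPow_mul_self hM]
  rw [toEuclideanLin_mul_apply, inner_toEuclideanLin (isHermitian_halfPow M),
    real_inner_self_eq_norm_sq, Real.sqrt_sq (norm_nonneg _)]

end SquareRoot

/-! ### Empirical moments -/

section EmpiricalMoments

open Matrix

variable {d n : ℕ}

theorem toEuclideanLin_empSecondMoment (x : Fin n → EuclideanSpace ℝ (Fin d))
    (v : EuclideanSpace ℝ (Fin d)) :
    toEuclideanLin (empSecondMoment x) v = empMean fun k => inner ℝ (x k) v • x k := by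
  ext i
  simp only [ofLp_toLpLin, toLin'_apply, mulVec, dotProduct, empSecondMoment, Matrix.of_apply,
    empMean, PiLp.smul_apply, smul_eq_mul, PiLp.inner_apply, WithLp.ofLp_sum, Finset.sum_apply,
    RCLike.inner_apply, conj_trivial, Finset.sum_mul, Finset.mul_sum, Finset.sum_div]
  rw [Finset.sum_comm]
  exact Finset.sum_congr rfl fun k _ => Finset.sum_congr rfl fun j _ => by ring

theorem natCast_smul_empMean (v : Fin n → EuclideanSpace ℝ (Fin d)) :
    (n : ℝ) • empMean v = ∑ k, v k := by
  rcases n.eq_zero_or_pos with rfl | hn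
  · simp
  · rw [empMean, smul_inv_smul₀ (by positivity)]

theorem natCast_mul_inner_empSecondMoment (x : Fin n → EuclideanSpace ℝ (Fin d))
    (v : EuclideanSpace ℝ (Fin d)) :
    n * inner ℝ v (toEuclideanLin (empSecondMoment x) v) = ∑ k, inner ℝ v (x k) ^ 2 := by
  rw [toEuclideanLin_empSecondMoment, ← real_inner_smul_right, natCast_smul_empMean, inner_sum]
  refine Finset.sum_congr rfl fun k _ => ?_
  rw [real_inner_smul_right, real_inner_comm v, sq]

theorem posSemidef_empSecondMoment (x : Fin n → EuclideanSpace ℝ (Fin d)) :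
    (empSecondMoment x).PosSemidef := by
  refine posSemidef_of_inner_nonneg (IsHermitian.ext fun i j => ?_) fun v => ?_
  · simp [empSecondMoment, mul_comm]
  · rcases n.eq_zero_or_pos with rfl | hn
    · simp [toEuclideanLin_empSecondMoment, empMean]
    · have hn' : (0 : ℝ) < n := by exact_mod_cast hn
      refine nonneg_of_mul_nonneg_right ?_ hn'
      rw [natCast_mul_inner_empSecondMoment]
      positivity

theorem empContribution_eq (x : Fin n → EuclideanSpace ℝ (Fin d)) (u : Fin n → ℝ) :
    empContribution x u =
      toEuclideanLin (empSecondMoment x)⁻¹ (empMean fun k => u k • x k) := by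
  simp [empContribution, empMean]

theorem sum_inner_negHalfPow_empSecondMoment_sq_le (x : Fin n → EuclideanSpace ℝ (Fin d))
    (u : EuclideanSpace ℝ (Fin d)) :
    ∑ k, inner ℝ u (toEuclideanLin (negHalfPow (empSecondMoment x)) (x k)) ^ 2 ≤ n * ‖u‖ ^ 2 := by
  have hS := posSemidef_empSecondMoment x
  by_cases hu : IsUnit (empSecondMoment x)
  · simp only [inner_toEuclideanLin (isHermitian_negHalfPow _)]
    rw [← natCast_mul_inner_empSecondMoment, inner_negHalfPow_mul_negHalfPow hS hu,
      real_inner_self_eq_norm_sq]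
  · have h0 : 0 ≤ n * ‖u‖ ^ 2 := by positivity
    simpa [negHalfPow_of_not_isUnit hS hu] using h0

theorem measurable_empSecondMoment_inv_apply (i j : Fin d) :
    Measurable fun x : Fin n → EuclideanSpace ℝ (Fin d) => (empSecondMoment x)⁻¹ i j := by
  have hcont : Continuous fun x : Fin n → EuclideanSpace ℝ (Fin d) => empSecondMoment x := by
    refine continuous_matrix fun i j => ?_
    simp only [empSecondMoment, Matrix.of_apply]
    fun_prop
  simp only [Matrix.inv_def, Matrix.smul_apply, smul_eq_mul, Ring.inverse_eq_inv']
  exact hcont.matrix_det.measurable.inv.mul (hcont.matrix_adjugate.matrix_elem i j).measurable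

theorem measurable_inner_empSecondMoment_inv {α : Type*} [MeasurableSpace α]
    {x : α → Fin n → EuclideanSpace ℝ (Fin d)} {v : α → EuclideanSpace ℝ (Fin d)}
    (hx : Measurable x) (hv : Measurable v) :
    Measurable fun a => inner ℝ (v a) (toEuclideanLin (empSecondMoment (x a))⁻¹ (v a)) := by
  have hcoord (i : Fin d) : Measurable fun a => v a i := by fun_prop
  simp only [PiLp.inner_apply, ofLp_toLpLin, toLin'_apply, mulVec, dotProduct, RCLike.inner_apply,
    conj_trivial]
  exact Finset.measurable_sum _ fun i _ => (Finset.measurable_sum _ fun j _ =>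
    ((measurable_empSecondMoment_inv_apply i j).comp hx).mul (hcoord j)).mul (hcoord i)

end EmpiricalMoments

/-! ### Noise -/

section Noise

open Matrix

theorem IsSubgaussian.of_forall_rat {α : Type*} [MeasurableSpace α] {ν : Measure α} {w : α → ℝ}
    {v : ℝ} (hw : Measurable w) (h : ∀ q : ℚ, ∫⁻ a, ENNReal.ofReal (Real.exp (q * w a)) ∂ν ≤
      ENNReal.ofReal (Real.exp (v * q ^ 2 / 2))) : IsSubgaussian ν w v := by
  have hnn (l : ℝ) : 0 ≤ᵐ[ν] fun a => Real.exp (l * w a) := .of_forall fun _ => (Real.exp_pos _).le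
  have hintq (q : ℚ) : Integrable (fun a => Real.exp (q * w a)) ν := by
    rw [← lintegral_ofReal_ne_top_iff_integrable (by fun_prop) (hnn q)]
    exact ((h q).trans_lt ENNReal.ofReal_lt_top).ne
  have hint (l : ℝ) : Integrable (fun a => Real.exp (l * w a)) ν :=
    integrable_exp_mul_of_le_of_le (by simpa using hintq ⌊l⌋) (by simpa using hintq ⌈l⌉)
      (Int.floor_le l) (Int.le_ceil l)
  have hmgf (l : ℝ) : mgf w ν l ≤ Real.exp (v * l ^ 2 / 2) := by
    refine Rat.denseRange_cast.induction_on l (isClosed_le (continuous_mgf hint) (by fun_prop))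
      fun q => ?_
    have hq := h q
    rwa [← ofReal_integral_eq_lintegral_ofReal (hint q) (hnn q),
      ENNReal.ofReal_le_ofReal_iff (Real.exp_pos _).le] at hq
  intro l
  have hinner (a : α) : inner ℝ l (w a) = l * w a := by simp [mul_comm]
  simp only [hinner, Real.norm_eq_abs, sq_abs]
  rw [← ofReal_integral_eq_lintegral_ofReal (hint l) (hnn l)]
  exact ENNReal.ofReal_le_ofReal (hmgf l)

variable {Ω : Type*} [MeasurableSpace Ω] {d n : ℕ} {μ : Measure Ω}
  {X : Ω → EuclideanSpace ℝ (Fin d)} {Y : Ω → ℝ} {σ : ℝ}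

@[fun_prop]
theorem measurable_regression [IsFiniteMeasure μ] : Measurable (regression μ X Y) :=
  (StronglyMeasurable.integral_condDistrib (X := X) (Y := Y) (μ := μ)
    measurable_snd.stronglyMeasurable).measurable

@[fun_prop]
theorem measurable_noise [IsFiniteMeasure μ] (x : EuclideanSpace ℝ (Fin d)) :
    Measurable (noise μ X Y x) := by
  unfold noise
  fun_prop

theorem SubgaussianNoise.ae_lintegral_exp_le [IsFiniteMeasure μ] (h : SubgaussianNoise μ X Y σ)
    (hX : Measurable X) (hY : Measurable Y) (l : ℝ) :
    ∀ᵐ x ∂(μ.map X), ∫⁻ y, ENNReal.ofReal (Real.exp (l * noise μ X Y x y)) ∂(condDistrib Y X μ x) ≤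
      ENNReal.ofReal (Real.exp (σ ^ 2 * l ^ 2 / 2)) := by
  let f : EuclideanSpace ℝ (Fin d) × ℝ → ℝ := fun p => Real.exp (l * noise μ X Y p.1 p.2)
  have hf : StronglyMeasurable f := by
    refine Measurable.stronglyMeasurable ?_
    simp only [f, noise]
    fun_prop
  obtain ⟨hint, hle⟩ := h.2 l
  have hintf : Integrable f (μ.map fun ω => (X ω, Y ω)) :=
    (integrable_map_measure hf.aestronglyMeasurable (hX.prodMk hY).aemeasurable).2 hint
  have hmean : ∀ᵐ x ∂(μ.map X), ∫ y, f (x, y) ∂(condDistrib Y X μ x) ≤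
      Real.exp (l ^ 2 * σ ^ 2 / 2) := by
    rw [ae_map_iff hX.aemeasurable
      (measurableSet_le hf.integral_condDistrib.measurable measurable_const)]
    filter_upwards [condExp_prod_ae_eq_integral_condDistrib' hX hY.aemeasurable hintf, hle]
      with ω hω hle
    rwa [← hω]
  filter_upwards [hmean, hintf.condDistrib_ae_map hY.aemeasurable] with x hx hintx
  rw [← ofReal_integral_eq_lintegral_ofReal hintx (.of_forall fun _ => (Real.exp_pos _).le),
    mul_comm (σ ^ 2)]
  exact ENNReal.ofReal_le_ofReal hx

theorem SubgaussianNoise.ae_isSubgaussian [IsFiniteMeasure μ] (h : SubgaussianNoise μ X Y σ)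
    (hX : Measurable X) (hY : Measurable Y) :
    ∀ᵐ x ∂(μ.map X), IsSubgaussian (condDistrib Y X μ x) (noise μ X Y x) (σ ^ 2) := by
  filter_upwards [ae_all_iff.2 fun q : ℚ => h.ae_lintegral_exp_le hX hY q] with x hx
  exact .of_forall_rat (measurable_noise x) hx

theorem IsSubgaussian.measure_lt_inner_empSecondMoment_inv_le {α : Type*} [MeasurableSpace α]
    {κ : Fin n → Measure α} [∀ k, IsProbabilityMeasure (κ k)] {η : Fin n → α → ℝ}
    (hη : ∀ k, Measurable (η k)) {v : ℝ} (h : ∀ k, IsSubgaussian (κ k) (η k) v) (hv : 0 ≤ v)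
    (x : Fin n → EuclideanSpace ℝ (Fin d)) {t : ℝ} (ht : 0 ≤ t) :
    Measure.pi κ {y | n * (v * (d + 2 * √(d * t) + 2 * t)) <
      inner ℝ (∑ k, η k (y k) • x k)
        (toEuclideanLin (empSecondMoment x)⁻¹ (∑ k, η k (y k) • x k))} ≤
      ENNReal.ofReal (Real.exp (-t)) := by
  have hS := posSemidef_empSecondMoment x
  have hsum := IsSubgaussian.sum_smul hη h hv _ (sum_inner_negHalfPow_empSecondMoment_sq_le x)
  refine (measure_mono fun y hy => ?_).trans
    (hsum.measure_lt_norm_sq_le (by fun_prop) (by positivity) ht)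
  simp only [Set.mem_ofPred_eq, finrank_euclideanSpace_fin, ← map_smul, ← map_sum,
    norm_sq_toEuclideanLin_negHalfPow hS] at hy ⊢
  linarith

theorem SubgaussianNoise.measure_lt_inner_empSecondMoment_inv_le [IsProbabilityMeasure μ]
    (h : SubgaussianNoise μ X Y σ) (hX : Measurable X) (hY : Measurable Y) {t : ℝ} (ht : 0 ≤ t) :
    Measure.pi (fun _ : Fin n => μ.map fun ω => (X ω, Y ω))
      {z | n * (σ ^ 2 * (d + 2 * √(d * t) + 2 * t)) <
        inner ℝ (∑ k, noise μ X Y (z k).1 (z k).2 • (z k).1)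
          (toEuclideanLin (empSecondMoment fun k => (z k).1)⁻¹
            (∑ k, noise μ X Y (z k).1 (z k).2 • (z k).1))} ≤
      ENNReal.ofReal (Real.exp (-t)) := by
  have : IsProbabilityMeasure (μ.map X) := Measure.isProbabilityMeasure_map hX.aemeasurable
  have hae : ∀ᵐ x ∂(Measure.pi fun _ : Fin n => μ.map X), ∀ k,
      IsSubgaussian (condDistrib Y X μ (x k)) (noise μ X Y (x k)) (σ ^ 2) :=
    ae_all_iff.2 fun k =>
      (Measure.tendsto_eval_ae_ae (μ := fun _ => μ.map X) (i := k)).eventually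
        (h.ae_isSubgaussian hX hY)
  have hsum : Measurable fun z : Fin n → EuclideanSpace ℝ (Fin d) × ℝ =>
      ∑ k, noise μ X Y (z k).1 (z k).2 • (z k).1 := by
    simp only [noise]
    fun_prop
  have hevent := measurableSet_lt
    (measurable_const (a := n * (σ ^ 2 * (d + 2 * √(d * t) + 2 * t))))
    (measurable_inner_empSecondMoment_inv
      (x := fun (z : Fin n → EuclideanSpace ℝ (Fin d) × ℝ) k => (z k).1) (by fun_prop) hsum)
  rw [← compProd_map_condDistrib hY.aemeasurable, pi_compProd,
    Measure.map_apply (MeasurableEquiv.measurable _) hevent,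
    Measure.compProd_apply (MeasurableEquiv.measurable _ hevent)]
  calc _ ≤ ∫⁻ _, ENNReal.ofReal (Real.exp (-t)) ∂(Measure.pi fun _ : Fin n => μ.map X) := by
        refine lintegral_mono_ae ?_
        filter_upwards [hae] with x hx
        exact IsSubgaussian.measure_lt_inner_empSecondMoment_inv_le
          (fun k => measurable_noise (x k)) hx (sq_nonneg σ) x ht
    _ = _ := by simp

end Noise

/-! ### Error bounds for one sample -/

section Deterministic

open Matrix

theorem norm_le_of_sq_le_inner {E : Type*} [SeminormedAddCommGroup E] [InnerProductSpace ℝ E]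
    {u v : E} {K : ℝ} (hK : 0 ≤ K) (h : ‖v‖ ^ 2 ≤ K * inner ℝ u v) : ‖v‖ ≤ K * ‖u‖ := by
  rcases (norm_nonneg v).eq_or_lt with h0 | h0
  · rw [← h0]
    positivity
  · refine le_of_mul_le_mul_right ?_ h0
    calc ‖v‖ * ‖v‖ = ‖v‖ ^ 2 := (sq _).symm
      _ ≤ K * inner ℝ u v := h
      _ ≤ K * (‖u‖ * ‖v‖) := by gcongr; exact real_inner_le_norm u v
      _ = K * ‖u‖ * ‖v‖ := by ring

variable {d n : ℕ} {S : Matrix (Fin d) (Fin d) ℝ} {x : Fin n → EuclideanSpace ℝ (Fin d)} {K : ℝ}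

theorem matNorm_add_le (hS : S.PosSemidef) (u v : EuclideanSpace ℝ (Fin d)) :
    matNorm S (u + v) ≤ matNorm S u + matNorm S v := by
  simp only [matNorm_eq_norm_halfPow hS, map_add]
  exact norm_add_le _ _

/-- The empirical second moment of the sample whitened by `S` is at least `K⁻¹` times the identity,
as a quadratic form. All matrix errors of the sample are controlled through this one inequality. -/
def WhitenedLowerBound (S : Matrix (Fin d) (Fin d) ℝ) (x : Fin n → EuclideanSpace ℝ (Fin d))
    (K : ℝ) : Prop :=
  ∀ u, n * (K⁻¹ * ‖u‖ ^ 2) ≤ ∑ k, inner ℝ u (toEuclideanLin (negHalfPow S) (x k)) ^ 2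

namespace WhitenedLowerBound

theorem norm_halfPow_sq_le (h : WhitenedLowerBound S x K) (hS : S.PosSemidef) (hSu : IsUnit S)
    (hn : 0 < n) (v : EuclideanSpace ℝ (Fin d)) :
    K⁻¹ * ‖toEuclideanLin (halfPow S) v‖ ^ 2 ≤
      inner ℝ v (toEuclideanLin (empSecondMoment x) v) := by
  have hn' : (0 : ℝ) < n := by exact_mod_cast hn
  have hv := h (toEuclideanLin (halfPow S) v)
  simp only [inner_toEuclideanLin (isHermitian_negHalfPow S),
    toEuclideanLin_negHalfPow_halfPow hS hSu] at hv
  rw [← natCast_mul_inner_empSecondMoment] at hv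
  exact le_of_mul_le_mul_left hv hn'

theorem posDef (h : WhitenedLowerBound S x K) (hS : S.PosSemidef) (hSu : IsUnit S) (hn : 0 < n)
    (hK : 0 < K) : (empSecondMoment x).PosDef := by
  refine posDef_of_inner_pos (posSemidef_empSecondMoment x).isHermitian fun v hv =>
    lt_of_lt_of_le ?_ (h.norm_halfPow_sq_le hS hSu hn v)
  have hne : toEuclideanLin (halfPow S) v ≠ 0 := fun h0 => hv <| by
    rw [← toEuclideanLin_negHalfPow_halfPow hS hSu v, h0, map_zero]
  positivity

theorem matNorm_sq_le (h : WhitenedLowerBound S x K) (hS : S.PosSemidef) (hSu : IsUnit S)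
    (hn : 0 < n) (hK : 0 < K) (m : EuclideanSpace ℝ (Fin d)) :
    matNorm S (toEuclideanLin (empSecondMoment x)⁻¹ m) ^ 2 ≤
      K * inner ℝ m (toEuclideanLin (empSecondMoment x)⁻¹ m) := by
  have hdet := (isUnit_iff_isUnit_det _).1 (h.posDef hS hSu hn hK).isUnit
  have hle := h.norm_halfPow_sq_le hS hSu hn (toEuclideanLin (empSecondMoment x)⁻¹ m)
  rwa [← toEuclideanLin_mul_apply (empSecondMoment x), mul_nonsing_inv _ hdet,
    toEuclideanLin_one_apply, real_inner_comm, inv_mul_le_iff₀ hK,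
    ← matNorm_eq_norm_halfPow hS] at hle

theorem matNorm_le (h : WhitenedLowerBound S x K) (hS : S.PosSemidef) (hSu : IsUnit S)
    (hn : 0 < n) (hK : 0 < K) (m : EuclideanSpace ℝ (Fin d)) :
    matNorm S (toEuclideanLin (empSecondMoment x)⁻¹ m) ≤
      K * ‖toEuclideanLin (negHalfPow S) m‖ := by
  have hle := h.matNorm_sq_le hS hSu hn hK m
  nth_rewrite 2 [← toEuclideanLin_halfPow_negHalfPow hS hSu m] at hle
  rw [← inner_toEuclideanLin (isHermitian_halfPow S)] at hle
  rw [matNorm_eq_norm_halfPow hS] at hle ⊢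
  exact norm_le_of_sq_le_inner hK.le hle

theorem specNorm_le (h : WhitenedLowerBound S x K) (hS : S.PosSemidef) (hSu : IsUnit S)
    (hn : 0 < n) (hK : 0 < K) : specNorm (halfPow S * (empSecondMoment x)⁻¹ * halfPow S) ≤ K := by
  refine ContinuousLinearMap.opNorm_le_bound _ hK.le fun v => ?_
  change ‖toEuclideanLin (halfPow S * (empSecondMoment x)⁻¹ * halfPow S) v‖ ≤ K * ‖v‖
  have hle := h.matNorm_le hS hSu hn hK (toEuclideanLin (halfPow S) v)
  rwa [toEuclideanLin_negHalfPow_halfPow hS hSu, matNorm_eq_norm_halfPow hS,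
    ← toEuclideanLin_mul_apply, ← toEuclideanLin_mul_apply] at hle

theorem matNorm_empContribution_le (h : WhitenedLowerBound S x K) (hS : S.PosSemidef)
    (hSu : IsUnit S) (hn : 0 < n) (hK : 0 < K) (u : Fin n → ℝ) :
    matNorm S (empContribution x u) ≤
      K * ((n : ℝ)⁻¹ * ‖∑ k, toEuclideanLin (negHalfPow S) (u k • x k)‖) := by
  rw [empContribution_eq]
  refine (h.matNorm_le hS hSu hn hK _).trans_eq ?_
  rw [empMean, map_smul, map_sum, norm_smul, norm_inv, Real.norm_natCast]

theorem matNorm_empContribution_sq_le (h : WhitenedLowerBound S x K) (hS : S.PosSemidef)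
    (hSu : IsUnit S) (hn : 0 < n) (hK : 0 < K) (u : Fin n → ℝ) :
    matNorm S (empContribution x u) ^ 2 ≤
      K * (((n : ℝ) ^ 2)⁻¹ * inner ℝ (∑ k, u k • x k)
        (toEuclideanLin (empSecondMoment x)⁻¹ (∑ k, u k • x k))) := by
  rw [empContribution_eq]
  refine (h.matNorm_sq_le hS hSu hn hK _).trans_eq ?_
  rw [empMean, map_smul, real_inner_smul_left, real_inner_smul_right, ← mul_assoc (n : ℝ)⁻¹,
    ← mul_inv, ← sq]

end WhitenedLowerBound

theorem ols_sub_eq_add (hu : IsUnit (empSecondMoment x)) {y b e : Fin n → ℝ}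
    {β : EuclideanSpace ℝ (Fin d)} (hy : ∀ k, y k = b k + e k + inner ℝ (x k) β) :
    ols x y - β = empContribution x b + empContribution x e := by
  have hmean : (empMean fun k => y k • x k) = (empMean fun k => b k • x k) +
      (empMean fun k => e k • x k) + toEuclideanLin (empSecondMoment x) β := by
    rw [toEuclideanLin_empSecondMoment]
    simp only [empMean, ← smul_add, ← Finset.sum_add_distrib, ← add_smul, hy]
  rw [ols, hmean, map_add, map_add, ← toEuclideanLin_mul_apply,
    nonsing_inv_mul _ ((isUnit_iff_isUnit_det _).1 hu), toEuclideanLin_one_apply,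
    empContribution_eq, empContribution_eq, add_sub_cancel_right]

theorem sampleBounds_of_whitenedLowerBound {Ω : Type*} [MeasurableSpace Ω] {μ : Measure Ω}
    [IsFiniteMeasure μ] {X : Ω → EuclideanSpace ℝ (Fin d)} {Y : Ω → ℝ} {σ B δ : ℝ}
    {y : Fin n → ℝ} (hS : (secondMoment μ X).PosSemidef) (hSu : IsUnit (secondMoment μ X))
    (hn : 0 < n) (hK : 0 < K) (h : WhitenedLowerBound (secondMoment μ X) x K)
    (happrox : ‖∑ k, whitenedApprox μ X Y (x k)‖ ^ 2 ≤
      4 * (n * ∫ ω, ‖whitenedApprox μ X Y (X ω)‖ ^ 2 ∂μ) * (1 + 8 * Real.log (1 / δ)) +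
        3 * (B * √d) ^ 2 * Real.log (1 / δ) ^ 2)
    (hnoise : inner ℝ (∑ k, noise μ X Y (x k) (y k) • x k)
        (toEuclideanLin (empSecondMoment x)⁻¹ (∑ k, noise μ X Y (x k) (y k) • x k)) ≤
      n * (σ ^ 2 * (d + 2 * √(d * Real.log (1 / δ)) + 2 * Real.log (1 / δ)))) :
    SampleBounds μ X Y σ B δ K x y := by
  have _hn' : (0 : ℝ) < n := by exact_mod_cast hn
  have hposDef := h.posDef hS hSu hn hK
  have hexcess : matNorm (secondMoment μ X) (ols x y - popCoef μ X Y) ≤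
      matNorm (secondMoment μ X) (empContribution x fun k => approxErr μ X Y (x k)) +
        matNorm (secondMoment μ X) (empContribution x fun k => noise μ X Y (x k) (y k)) := by
    rw [ols_sub_eq_add hposDef.isUnit (b := fun k => approxErr μ X Y (x k))
      (e := fun k => noise μ X Y (x k) (y k)) fun k => by simp only [approxErr, noise]; ring]
    exact matNorm_add_le hS _ _
  refine ⟨hposDef, h.specNorm_le hS hSu hn hK, ?_, ?_, hexcess, ?_⟩
  · refine (pow_le_pow_left₀ (Real.sqrt_nonneg _)
      (h.matNorm_empContribution_le hS hSu hn hK _) 2).trans ?_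
    rw [mul_pow, mul_pow]
    refine mul_le_mul_of_nonneg_left
      ((mul_le_mul_of_nonneg_left happrox (by positivity)).trans_eq ?_) (sq_nonneg K)
    rw [mul_pow, Real.sq_sqrt (by positivity)]
    field_simp
  · refine (h.matNorm_empContribution_sq_le hS hSu hn hK _).trans ?_
    refine mul_le_mul_of_nonneg_left
      ((mul_le_mul_of_nonneg_left hnoise (by positivity)).trans_eq ?_) hK.le
    field_simp
  · rw [← mul_add]
    exact (pow_le_pow_left₀ (Real.sqrt_nonneg _) hexcess 2).trans add_sq_le

end Deterministic

/-! ### Population moments -/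

section Population

open Matrix

variable {Ω : Type*} [MeasurableSpace Ω] {d : ℕ} {μ : Measure Ω}
  {X : Ω → EuclideanSpace ℝ (Fin d)} {Y : Ω → ℝ}

theorem integrable_apply_mul_apply (hX2 : MemLp X 2 μ) (i j : Fin d) :
    Integrable (fun ω => X ω i * X ω j) μ :=
  have hcoord (i : Fin d) : MemLp (fun ω => X ω i) 2 μ :=
    (EuclideanSpace.proj (𝕜 := ℝ) i).comp_memLp' hX2
  (hcoord i).integrable_mul (hcoord j)

theorem inner_smul_apply_eq_sum (x v : EuclideanSpace ℝ (Fin d)) (i : Fin d) :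
    (inner ℝ x v • x) i = ∑ j, x i * x j * v j := by
  simp only [PiLp.smul_apply, smul_eq_mul, PiLp.inner_apply, RCLike.inner_apply, conj_trivial,
    Finset.sum_mul]
  exact Finset.sum_congr rfl fun j _ => by ring

theorem integrable_inner_smul (hX2 : MemLp X 2 μ) (v : EuclideanSpace ℝ (Fin d)) :
    Integrable (fun ω => inner ℝ (X ω) v • X ω) μ := by
  refine Integrable.of_eval_piLp fun i => ?_
  simp only [inner_smul_apply_eq_sum]
  exact integrable_finsetSum _ fun j _ => (integrable_apply_mul_apply hX2 i j).mul_const _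

theorem toEuclideanLin_secondMoment (hX2 : MemLp X 2 μ) (v : EuclideanSpace ℝ (Fin d)) :
    toEuclideanLin (secondMoment μ X) v = ∫ ω, inner ℝ (X ω) v • X ω ∂μ := by
  ext i
  rw [eval_integral_piLp fun i => (integrable_inner_smul hX2 v).eval_piLp i]
  simp only [inner_smul_apply_eq_sum]
  rw [integral_finsetSum _ fun j _ => (integrable_apply_mul_apply hX2 i j).mul_const _]
  simp [secondMoment, mulVec, dotProduct, integral_mul_const]

theorem inner_toEuclideanLin_secondMoment (hX2 : MemLp X 2 μ) (v : EuclideanSpace ℝ (Fin d)) :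
    inner ℝ v (toEuclideanLin (secondMoment μ X) v) = ∫ ω, inner ℝ v (X ω) ^ 2 ∂μ := by
  rw [toEuclideanLin_secondMoment hX2, ← integral_inner (integrable_inner_smul hX2 v)]
  simp only [real_inner_smul_right, real_inner_comm v, sq]

theorem posSemidef_secondMoment (hX2 : MemLp X 2 μ) : (secondMoment μ X).PosSemidef := by
  refine posSemidef_of_inner_nonneg (IsHermitian.ext fun i j => ?_) fun v => ?_
  · simp [secondMoment, mul_comm]
  · rw [inner_toEuclideanLin_secondMoment hX2]
    exact integral_nonneg fun ω => sq_nonneg _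

theorem integral_inner_negHalfPow_sq (hX2 : MemLp X 2 μ) (hS : IsUnit (secondMoment μ X))
    (u : EuclideanSpace ℝ (Fin d)) :
    ∫ ω, inner ℝ u (toEuclideanLin (negHalfPow (secondMoment μ X)) (X ω)) ^ 2 ∂μ = ‖u‖ ^ 2 := by
  simp only [inner_toEuclideanLin (isHermitian_negHalfPow _)]
  rw [← inner_toEuclideanLin_secondMoment hX2,
    inner_negHalfPow_mul_negHalfPow (posSemidef_secondMoment hX2) hS, real_inner_self_eq_norm_sq]

@[fun_prop]
theorem measurable_toEuclideanLin (M : Matrix (Fin d) (Fin d) ℝ) : Measurable (toEuclideanLin M) :=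
  (toEuclideanLin M).continuous_of_finiteDimensional.measurable

variable [IsFiniteMeasure μ]

@[fun_prop]
theorem measurable_whitenedApprox : Measurable (whitenedApprox μ X Y) := by
  unfold whitenedApprox approxErr
  fun_prop

theorem regression_smul_ae_eq_condExp (hX : Measurable X) (hY : Integrable Y μ)
    (hXY : Integrable (fun ω => Y ω • X ω) μ) :
    (fun ω => regression μ X Y (X ω) • X ω) =ᵐ[μ]
      μ[fun ω => Y ω • X ω | MeasurableSpace.comap X inferInstance] := by
  refine .trans ?_ (condExp_smul_of_aestronglyMeasurable_right hY hXY
    (comap_measurable X).stronglyMeasurable.aestronglyMeasurable).symm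
  filter_upwards [regression_comp_ae_eq_condExp μ hX hY] with ω hω
  simp [hω]

theorem integrable_regression_smul (hX : Measurable X) (hY : Integrable Y μ)
    (hXY : Integrable (fun ω => Y ω • X ω) μ) :
    Integrable (fun ω => regression μ X Y (X ω) • X ω) μ :=
  integrable_condExp.congr (regression_smul_ae_eq_condExp hX hY hXY).symm

theorem integrable_approxErr_smul (hX : Measurable X) (hX2 : MemLp X 2 μ) (hY : Integrable Y μ)
    (hXY : Integrable (fun ω => Y ω • X ω) μ) :
    Integrable (fun ω => approxErr μ X Y (X ω) • X ω) μ := by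
  simp only [approxErr, sub_smul]
  exact (integrable_regression_smul hX hY hXY).sub (integrable_inner_smul hX2 _)

theorem integral_approxErr_smul (hX : Measurable X) (hX2 : MemLp X 2 μ) (hY : Integrable Y μ)
    (hXY : Integrable (fun ω => Y ω • X ω) μ) (hS : IsUnit (secondMoment μ X)) :
    ∫ ω, approxErr μ X Y (X ω) • X ω ∂μ = 0 := by
  simp only [approxErr, sub_smul]
  rw [integral_sub (integrable_regression_smul hX hY hXY) (integrable_inner_smul hX2 _),
    integral_congr_ae (regression_smul_ae_eq_condExp hX hY hXY), integral_condExp hX.comap_le,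
    ← toEuclideanLin_secondMoment hX2, popCoef, ← toEuclideanLin_mul_apply,
    mul_nonsing_inv _ ((isUnit_iff_isUnit_det _).1 hS), toEuclideanLin_one_apply, sub_self]

theorem integral_whitenedApprox (hX : Measurable X) (hX2 : MemLp X 2 μ) (hY : Integrable Y μ)
    (hXY : Integrable (fun ω => Y ω • X ω) μ) (hS : IsUnit (secondMoment μ X)) :
    ∫ ω, whitenedApprox μ X Y (X ω) ∂μ = 0 := by
  have hcomm := (toEuclideanLin (negHalfPow (secondMoment μ X))).toContinuousLinearMap
    |>.integral_comp_comm (integrable_approxErr_smul hX hX2 hY hXY)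
  rwa [integral_approxErr_smul hX hX2 hY hXY hS, map_zero] at hcomm

end Population

/-! ### Sample sizes and factors -/

section Factors

variable {d n : ℕ} {ρ δ : ℝ}

theorem natCast_mul_log_add_log_pos (d : ℕ) (hδ0 : 0 < δ) (hδ1 : δ < 1) :
    0 < d * Real.log 41 + Real.log (2 / δ) := by
  have _h41 : 0 ≤ Real.log 41 := Real.log_nonneg (by norm_num)
  have hlog : 0 < Real.log (2 / δ) := Real.log_pos (by rw [lt_div_iff₀ hδ0]; linarith)
  positivity

theorem natCast_mul_log_div_nonneg (d : ℕ) (hδ0 : 0 < δ) (hδ1 : δ < 1) :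
    0 ≤ d * Real.log (d / δ) := by
  rcases Nat.eq_zero_or_pos d with rfl | hd
  · simp
  · have hd' : (1 : ℝ) ≤ d := by exact_mod_cast hd
    exact mul_nonneg d.cast_nonneg (Real.log_nonneg (by rw [le_div_iff₀ hδ0]; linarith))

theorem n₁_nonneg (hδ0 : 0 < δ) (hδ1 : δ < 1) : 0 ≤ n₁ ρ d δ :=
  mul_nonneg (by positivity) (natCast_mul_log_add_log_pos d hδ0 hδ1).le

theorem n₂_nonneg (hδ0 : 0 < δ) (hδ1 : δ < 1) : 0 ≤ n₂ ρ d δ := by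
  rw [n₂, mul_assoc]
  exact mul_nonneg (by positivity) (natCast_mul_log_div_nonneg d hδ0 hδ1)

theorem one_div_mem_Ioc {κ : ℝ} (h : 1 / 5 ≤ κ) : 1 / κ ∈ Set.Ioc 0 5 := by
  have hκ : 0 < κ := by linarith
  refine ⟨by positivity, ?_⟩
  rw [div_le_iff₀ hκ]
  linarith

theorem K₁_mem_Ioc (hρ : 1 ≤ ρ) (hδ0 : 0 < δ) (hδ1 : δ < 1) (hn : n₁ ρ d δ < n) :
    K₁ ρ d δ n ∈ Set.Ioc 0 5 := by
  refine one_div_mem_Ioc ?_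
  have hn' : (0 : ℝ) < n := (n₁_nonneg hδ0 hδ1).trans_lt hn
  have hL := natCast_mul_log_add_log_pos d hδ0 hδ1
  rw [n₁] at hn
  set L := d * Real.log 41 + Real.log (2 / δ)
  have hsqrt : ρ * √(32 * L / n) ≤ 17 / 25 := by
    rw [← Real.sqrt_sq (zero_le_one.trans hρ), ← Real.sqrt_mul (sq_nonneg _)]
    refine Real.sqrt_le_iff.2 ⟨by norm_num, ?_⟩
    rw [← mul_div_assoc, div_le_iff₀ hn']
    linarith
  have hlin : ρ * (2 * L / n) ≤ 1 / 35 := by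
    have hρL : ρ * L ≤ ρ ^ 2 * L := by gcongr; exact le_self_pow₀ hρ two_ne_zero
    rw [← mul_div_assoc, div_le_iff₀ hn']
    linarith
  linarith

theorem K₂_mem_Ioc (hδ0 : 0 < δ) (hδ1 : δ < 1) (hn : n₂ ρ d δ < n) :
    K₂ ρ d δ n ∈ Set.Ioc 0 5 := by
  refine one_div_mem_Ioc ?_
  have hn' : (0 : ℝ) < n := (n₂_nonneg hδ0 hδ1).trans_lt hn
  have hsqrt : √(2 * ρ ^ 2 * d * Real.log (d / δ) / n) ≤ 4 / 5 := by
    refine Real.sqrt_le_iff.2 ⟨by norm_num, ?_⟩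
    rw [n₂] at hn
    rw [div_le_iff₀ hn']
    linarith
  linarith

end Factors

/-! ### Deviation bounds for the sample -/

section Deviation

open Matrix

variable {Ω : Type*} [MeasurableSpace Ω] {d n : ℕ} {μ : Measure Ω}
  {X : Ω → EuclideanSpace ℝ (Fin d)} {Y : Ω → ℝ} {S : Matrix (Fin d) (Fin d) ℝ} {ρ B δ t : ℝ}

theorem setOf_not_whitenedLowerBound_one_div (κ : ℝ) :
    {x : Fin n → EuclideanSpace ℝ (Fin d) | ¬ WhitenedLowerBound S x (1 / κ)} =
      {x | ∃ u, ∑ k, inner ℝ u (toEuclideanLin (negHalfPow S) (x k)) ^ 2 < n * (κ * ‖u‖ ^ 2)} := by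
  simp only [WhitenedLowerBound, not_forall, not_le, one_div, inv_inv]

theorem integral_map_inner_negHalfPow_sq (hX : Measurable X) (hX2 : MemLp X 2 μ)
    (hS : IsUnit (secondMoment μ X)) (u : EuclideanSpace ℝ (Fin d)) :
    ∫ x, inner ℝ u (toEuclideanLin (negHalfPow (secondMoment μ X)) x) ^ 2 ∂(μ.map X) =
      ‖u‖ ^ 2 := by
  rw [integral_map hX.aemeasurable (Measurable.aestronglyMeasurable (by fun_prop)),
    integral_inner_negHalfPow_sq hX2 hS]

theorem SubgaussianProjections.isSubgaussian (h : SubgaussianProjections μ X ρ)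
    (hX : Measurable X) :
    IsSubgaussian (μ.map X) (toEuclideanLin (negHalfPow (secondMoment μ X))) ρ := fun u => by
  rw [lintegral_map (by fun_prop) hX, ← ofReal_integral_eq_lintegral_ofReal (h.2 u).1
    (.of_forall fun _ => (Real.exp_pos _).le)]
  exact ENNReal.ofReal_le_ofReal (h.2 u).2

theorem BoundedLeverage.ae_norm_sq_le (h : BoundedLeverage μ X ρ) (hX : Measurable X)
    (hd : 0 < d) :
    ∀ᵐ x ∂(μ.map X), ‖toEuclideanLin (negHalfPow (secondMoment μ X)) x‖ ^ 2 ≤ ρ ^ 2 * d := by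
  rw [ae_map_iff hX.aemeasurable (measurableSet_le (by fun_prop) measurable_const)]
  filter_upwards [h.2] with ω hω
  rw [div_le_iff₀ (by positivity)] at hω
  exact (pow_le_pow_left₀ (norm_nonneg _) hω 2).trans_eq
    (by rw [mul_pow, Real.sq_sqrt d.cast_nonneg])

variable [IsProbabilityMeasure μ]

theorem SubgaussianProjections.measure_not_whitenedLowerBound_le
    (h : SubgaussianProjections μ X ρ) (hX : Measurable X) (hX2 : MemLp X 2 μ)
    (hS : IsUnit (secondMoment μ X)) (hδ0 : 0 < δ) (hδ1 : δ < 1) (hn : 0 < n) :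
    Measure.pi (fun _ : Fin n => μ.map X)
      {x | ¬ WhitenedLowerBound (secondMoment μ X) x (K₁ ρ d δ n)} ≤ ENNReal.ofReal δ := by
  have : IsProbabilityMeasure (μ.map X) := Measure.isProbabilityMeasure_map hX.aemeasurable
  have : Nonempty (Fin n) := Fin.pos_iff_nonempty.1 hn
  have hbound := (h.isSubgaussian hX).measure_exists_sum_inner_sq_lt_le (ι := Fin n)
    (measurable_toEuclideanLin _) (zero_lt_one.trans_le h.1)
    (integral_map_inner_negHalfPow_sq hX hX2 hS) (natCast_mul_log_add_log_pos d hδ0 hδ1).le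
  rw [Fintype.card_fin, finrank_euclideanSpace_fin] at hbound
  rw [K₁, setOf_not_whitenedLowerBound_one_div]
  refine hbound.trans_eq (congrArg _ ?_)
  rw [Real.exp_neg, Real.exp_add, Real.exp_nat_mul, Real.exp_log (by norm_num),
    Real.exp_log (by positivity)]
  field_simp

theorem BoundedLeverage.measure_not_whitenedLowerBound_le (h : BoundedLeverage μ X ρ)
    (hX : Measurable X) (hX2 : MemLp X 2 μ) (hS : IsUnit (secondMoment μ X)) (hδ0 : 0 < δ)
    (hδ1 : δ < 1) (hn : 0 < n) :
    Measure.pi (fun _ : Fin n => μ.map X)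
      {x | ¬ WhitenedLowerBound (secondMoment μ X) x (K₂ ρ d δ n)} ≤ ENNReal.ofReal δ := by
  have : IsProbabilityMeasure (μ.map X) := Measure.isProbabilityMeasure_map hX.aemeasurable
  rw [K₂, setOf_not_whitenedLowerBound_one_div]
  rcases Nat.eq_zero_or_pos d with rfl | hd
  · simp [Subsingleton.elim _ (0 : EuclideanSpace ℝ (Fin 0))]
  have hρ : 0 < ρ := zero_lt_one.trans_le h.1
  have _hn' : (0 : ℝ) < n := by exact_mod_cast hn
  have hlog := natCast_mul_log_div_nonneg d hδ0 hδ1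
  have hbound := measure_exists_sum_inner_sq_lt_le (measurable_toEuclideanLin _)
    (by positivity) (h.ae_norm_sq_le hX hd) (integral_map_inner_negHalfPow_sq hX hX2 hS) n
    (Real.sqrt_nonneg (2 * ρ ^ 2 * d * Real.log (d / δ) / n))
  refine hbound.trans_eq (congrArg _ ?_)
  have hexponent : n * √(2 * ρ ^ 2 * d * Real.log (d / δ) / n) ^ 2 / (2 * (ρ ^ 2 * d)) =
      Real.log (d / δ) := by
    rw [Real.sq_sqrt (by rw [mul_assoc]; positivity)]
    field_simp
  rw [hexponent, finrank_euclideanSpace_fin, Real.exp_neg, Real.exp_log (by positivity)]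
  field_simp

theorem BoundedApprox.measure_lt_norm_sum_whitenedApprox_sq_le (h : BoundedApprox μ X Y B)
    (hX : Measurable X) (hX2 : MemLp X 2 μ) (hY1 : Integrable Y μ)
    (hXY : Integrable (fun ω => Y ω • X ω) μ) (hS : IsUnit (secondMoment μ X)) (ht : 0 ≤ t) :
    Measure.pi (fun _ : Fin n => μ.map X)
      {x | 4 * (n * ∫ ω, ‖whitenedApprox μ X Y (X ω)‖ ^ 2 ∂μ) * (1 + 8 * t) +
        3 * (B * √d) ^ 2 * t ^ 2 < ‖∑ k, whitenedApprox μ X Y (x k)‖ ^ 2} ≤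
      ENNReal.ofReal (Real.exp (-t)) := by
  have : IsProbabilityMeasure (μ.map X) := Measure.isProbabilityMeasure_map hX.aemeasurable
  have hM : ∀ᵐ x ∂(μ.map X), ‖whitenedApprox μ X Y x‖ ≤ B * √d := by
    rw [ae_map_iff hX.aemeasurable (measurableSet_le (by fun_prop) measurable_const)]
    exact h.2
  have hmean : ∫ x, whitenedApprox μ X Y x ∂(μ.map X) = 0 := by
    rw [integral_map hX.aemeasurable measurable_whitenedApprox.aestronglyMeasurable]
    exact integral_whitenedApprox hX hX2 hY1 hXY hS
  have hbound := measure_lt_norm_sum_sq_le measurable_whitenedApprox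
    (mul_nonneg h.1 (Real.sqrt_nonneg d)) hM hmean n ht
  rwa [integral_map hX.aemeasurable
    (measurable_whitenedApprox.norm.pow_const 2).aestronglyMeasurable] at hbound

end Deviation

/-! ### Independent copies -/

section Sample

variable {Ω Ω' α ι : Type*} [MeasurableSpace Ω] [MeasurableSpace Ω'] [MeasurableSpace α] [Fintype ι]
  {μ : Measure Ω} {P : Measure Ω'} [IsProbabilityMeasure P]

theorem map_eq_pi_of_iIndepFun_of_identDistrib {Zs : ι → Ω' → α} {Z : Ω → α}
    (hindep : iIndepFun Zs P) (hcopy : ∀ i, IdentDistrib (Zs i) Z P μ) :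
    P.map (fun ω i => Zs i ω) = Measure.pi fun _ => μ.map Z := by
  rw [(iIndepFun_iff_map_fun_eq_pi_map fun i => (hcopy i).aemeasurable_fst).1 hindep]
  exact congrArg Measure.pi (funext fun i => (hcopy i).map_eq)

theorem measureReal_setOf_le_of_pi_le {Zs : ι → Ω' → α} {Z : Ω → α} (hindep : iIndepFun Zs P)
    (hcopy : ∀ i, IdentDistrib (Zs i) Z P μ) {p : (ι → α) → Prop} {δ : ℝ} (hδ : 0 ≤ δ)
    (hp : Measure.pi (fun _ => μ.map Z) {z | p z} ≤ ENNReal.ofReal δ) :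
    P.real {ω | p fun i => Zs i ω} ≤ δ := by
  rw [← map_eq_pi_of_iIndepFun_of_identDistrib hindep hcopy] at hp
  exact ENNReal.toReal_le_of_le_ofReal hδ ((Measure.le_map_apply
    (aemeasurable_pi_lambda _ fun i => (hcopy i).aemeasurable_fst) _).trans hp)

theorem one_sub_le_measureReal_of_not_imp {p a b c : Ω' → Prop} {δ : ℝ}
    (ha : P.real {ω | a ω} ≤ δ) (hb : P.real {ω | b ω} ≤ δ) (hc : P.real {ω | c ω} ≤ δ)
    (h : ∀ ω, ¬ a ω → ¬ b ω → ¬ c ω → p ω) : 1 - 3 * δ ≤ P.real {ω | p ω} := by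
  have hcover : Set.univ ⊆ {ω | p ω} ∪ ({ω | a ω} ∪ ({ω | b ω} ∪ {ω | c ω})) := fun ω _ => by
    by_contra hω
    simp only [Set.mem_union, not_or] at hω
    exact hω.1 (h ω hω.2.1 hω.2.2.1 hω.2.2.2)
  have hone : 1 ≤ P.real ({ω | p ω} ∪ ({ω | a ω} ∪ ({ω | b ω} ∪ {ω | c ω}))) :=
    (probReal_univ (μ := P)).ge.trans (measureReal_mono hcover)
  linarith [measureReal_union_le (μ := P) {ω | p ω} ({ω | a ω} ∪ ({ω | b ω} ∪ {ω | c ω})),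
    measureReal_union_le (μ := P) {ω | a ω} ({ω | b ω} ∪ {ω | c ω}),
    measureReal_union_le (μ := P) {ω | b ω} {ω | c ω}]

variable [IsProbabilityMeasure μ] {d n : ℕ} {X : Ω → EuclideanSpace ℝ (Fin d)} {Y : Ω → ℝ}
  {Xs : Fin n → Ω' → EuclideanSpace ℝ (Fin d)} {Ys : Fin n → Ω' → ℝ} {σ B δ K : ℝ}

theorem one_sub_le_measureReal_sampleBounds (hX : Measurable X) (hY : Measurable Y)
    (hX2 : MemLp X 2 μ) (hY1 : Integrable Y μ) (hXY : Integrable (fun ω => Y ω • X ω) μ)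
    (hS : IsUnit (secondMoment μ X)) (hindep : iIndepFun (fun i ω => (Xs i ω, Ys i ω)) P)
    (hcopy : ∀ i, IdentDistrib (fun ω => (Xs i ω, Ys i ω)) (fun ω => (X ω, Y ω)) P μ)
    (hδ0 : 0 < δ) (hδ1 : δ < 1) (hnoise : SubgaussianNoise μ X Y σ)
    (happrox : BoundedApprox μ X Y B) (hn : 0 < n) (hK : 0 < K)
    (hmat : Measure.pi (fun _ : Fin n => μ.map X)
      {x | ¬ WhitenedLowerBound (secondMoment μ X) x K} ≤ ENNReal.ofReal δ) :
    1 - 3 * δ ≤ P.real {ω | SampleBounds μ X Y σ B δ K (fun i => Xs i ω) (fun i => Ys i ω)} := by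
  have hindepX : iIndepFun Xs P := hindep.comp (fun _ => Prod.fst) fun _ => measurable_fst
  have hcopyX (i : Fin n) : IdentDistrib (Xs i) X P μ := (hcopy i).comp measurable_fst
  have ht : 0 ≤ Real.log (1 / δ) := Real.log_nonneg ((one_le_div hδ0).2 hδ1.le)
  have hexp : Real.exp (-Real.log (1 / δ)) = δ := by
    rw [one_div, Real.log_inv, neg_neg, Real.exp_log hδ0]
  have happroxBound := happrox.measure_lt_norm_sum_whitenedApprox_sq_le (n := n) hX hX2 hY1 hXY hS
    ht
  have hnoiseBound := hnoise.measure_lt_inner_empSecondMoment_inv_le (n := n) hX hY ht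
  rw [hexp] at happroxBound hnoiseBound
  exact one_sub_le_measureReal_of_not_imp
    (measureReal_setOf_le_of_pi_le hindepX hcopyX hδ0.le hmat)
    (measureReal_setOf_le_of_pi_le hindepX hcopyX hδ0.le happroxBound)
    (measureReal_setOf_le_of_pi_le hindep hcopy hδ0.le hnoiseBound)
    fun ω hω happroxω hnoiseω => sampleBounds_of_whitenedLowerBound (posSemidef_secondMoment hX2) hS
      hn hK (not_not.1 hω) (not_lt.1 happroxω) (not_lt.1 hnoiseω)

end Sample

end RandomDesign

theorem theorem2 {Ω Ω' : Type*} [MeasurableSpace Ω] [MeasurableSpace Ω']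
    (μ : Measure Ω) [IsProbabilityMeasure μ] (P : Measure Ω') [IsProbabilityMeasure P]
    {d n : ℕ}
    -- the population pair
    (X : Ω → EuclideanSpace ℝ (Fin d)) (Y : Ω → ℝ)
    (hX : Measurable X) (hY : Measurable Y)
    (hX2 : MemLp X 2 μ) (hY1 : Integrable Y μ) (hXY : Integrable (fun ω => Y ω • X ω) μ)
    (hS : IsUnit (secondMoment μ X))
    -- the sample: `n` independent copies of the population pair
    (Xs : Fin n → Ω' → EuclideanSpace ℝ (Fin d)) (Ys : Fin n → Ω' → ℝ)
    (hindep : iIndepFun (fun i ω => (Xs i ω, Ys i ω)) P)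
    (hcopy : ∀ i, IdentDistrib (fun ω => (Xs i ω, Ys i ω)) (fun ω => (X ω, Y ω)) P μ)
    (σ B δ : ℝ) (hδ0 : 0 < δ) (hδ1 : δ < 1)
    (hnoise : SubgaussianNoise μ X Y σ) (happrox : BoundedApprox μ X Y B) :
    (∀ ρ₁ : ℝ, SubgaussianProjections μ X ρ₁ → n₁ ρ₁ d δ < n →
      K₁ ρ₁ d δ n ≤ 5 ∧
      1 - 3 * δ ≤ P.real {ω | SampleBounds μ X Y σ B δ (K₁ ρ₁ d δ n)
        (fun i => Xs i ω) (fun i => Ys i ω)}) ∧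
    (∀ ρ₂ : ℝ, BoundedLeverage μ X ρ₂ → n₂ ρ₂ d δ < n →
      K₂ ρ₂ d δ n ≤ 5 ∧
      1 - 3 * δ ≤ P.real {ω | SampleBounds μ X Y σ B δ (K₂ ρ₂ d δ n)
        (fun i => Xs i ω) (fun i => Ys i ω)}) := by
  refine ⟨fun ρ h hn => ?_, fun ρ h hn => ?_⟩
  · have hn0 : 0 < n := by exact_mod_cast (n₁_nonneg hδ0 hδ1).trans_lt hn
    have hK := K₁_mem_Ioc h.1 hδ0 hδ1 hn
    exact ⟨hK.2, one_sub_le_measureReal_sampleBounds hX hY hX2 hY1 hXY hS hindep hcopy hδ0 hδ1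
      hnoise happrox hn0 hK.1 (h.measure_not_whitenedLowerBound_le hX hX2 hS hδ0 hδ1 hn0)⟩
  · have hn0 : 0 < n := by exact_mod_cast (n₂_nonneg hδ0 hδ1).trans_lt hn
    have hK := K₂_mem_Ioc hδ0 hδ1 hn
    exact ⟨hK.2, one_sub_le_measureReal_sampleBounds hX hY hX2 hY1 hXY hS hindep hcopy hδ0 hδ1
      hnoise happrox hn0 hK.1 (h.measure_not_whitenedLowerBound_le hX hX2 hS hδ0 hδ1 hn0)⟩
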